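/- Let $n\ge 3$ be an integer. For a finite simple graph $G$ of order $n$ with degree matrix $D(G)$ and adjacency matrix $A(G)$, let $\nu_1(G)\ge\cdots\ge\nu_n(G)$ be the eigenvalues, counted with multiplicity, of the signless Laplacian matrix $Q(G)=D(G)+A(G)$, and let $IE(G)=\sum_{i=1}^n\sqrt{\nu_i(G)}$ be the incidence energy of $G$. A unicyclic graph is a connected graph with as many edges as vertices; its girth is the length of its unique cycle. Let $S_3'$ be the graph of order $n$ obtained from a triangle by attaching $n-3$ pendent edges at one of its vertices. Then $S_3'$ is a unicyclic graph of order $n$ with odd girth, and every unicyclic graph $G$ of order $n$ with odd girth satisfies $IE(G)\ge IE(S_3')$, with equality if and only if $G$ is isomorphic to $S_3'$. -/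

import Mathlib

/-- A unicyclic graph: a connected graph with as many edges as vertices. -/
def SimpleGraph.IsUnicyclic {V : Type*} [Fintype V] (G : SimpleGraph V) : Prop :=
  G.Connected ∧ G.edgeSet.ncard = Fintype.card V

/-- The signless Laplacian matrix `Q(G) = D(G) + A(G)`. -/
def SimpleGraph.signlessLapMatrix {V : Type*} [Fintype V] [DecidableEq V]
    (G : SimpleGraph V) [DecidableRel G.Adj] : Matrix V V ℝ :=
  G.degMatrix ℝ + G.adjMatrix ℝ

theorem SimpleGraph.isHermitian_signlessLapMatrix {V : Type*} [Fintype V] [DecidableEq V]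
    (G : SimpleGraph V) [DecidableRel G.Adj] : G.signlessLapMatrix.IsHermitian := by
  rw [Matrix.IsHermitian, Matrix.conjTranspose_eq_transpose_of_trivial,
    SimpleGraph.signlessLapMatrix, Matrix.transpose_add, SimpleGraph.degMatrix,
    Matrix.diagonal_transpose, SimpleGraph.transpose_adjMatrix]

/-- The incidence energy: the sum of the square roots of the eigenvalues, counted with
multiplicity, of the (positive semidefinite) signless Laplacian matrix. -/
noncomputable def SimpleGraph.incidenceEnergy {V : Type*} [Fintype V] [DecidableEq V]
    (G : SimpleGraph V) [DecidableRel G.Adj] : ℝ :=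
  ∑ i : V, Real.sqrt (G.isHermitian_signlessLapMatrix.eigenvalues i)

/-- The triangle on `Fin 3` with `k` pendent edges, whose pendent ends form `Fin k`, attached
at the vertex `2` of the triangle. -/
def trianglePendant (k : ℕ) : SimpleGraph (Fin 3 ⊕ Fin k) where
  Adj x y := match x, y with
    | .inl a, .inl b => a ≠ b
    | .inl a, .inr _ => a = 2
    | .inr _, .inl b => b = 2
    | .inr _, .inr _ => False
  symm := ⟨by
    rintro (a | a) (b | b) h
    · exact Ne.symm h
    · exact h
    · exact h
    · exact h⟩
  loopless := ⟨by
    rintro (a | a) h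
    · exact h rfl
    · exact h⟩

instance trianglePendant.decidableAdj (k : ℕ) : DecidableRel (trianglePendant k).Adj
  | .inl a, .inl b => inferInstanceAs (Decidable (a ≠ b))
  | .inl a, .inr _ => inferInstanceAs (Decidable (a = 2))
  | .inr _, .inl b => inferInstanceAs (Decidable (b = 2))
  | .inr _, .inr _ => inferInstanceAs (Decidable False)

/-! For `ν ≥ 0`, `π √ν = ∫₀^∞ log (1 + ν s²) / s² ds`, so the incidence energy is an increasing
functional of the function `t ↦ det (1 + t Q)` on `t > 0` (`sum_sqrt_le_sum_sqrt`). It thus suffices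
to compare these determinants for every `t`. For the triangle with pendent edges, `(1 + t)³ det (1 +
t Q) = (1 + t)ⁿ pendantCubic n t` (`det_trianglePendant`); the right side must bound the left from
below for every unicyclic graph of odd girth.

The bound is proved by induction on connected, non-bipartite vertex sets with as many edges as
vertices (`ConnectedOn.le_pminor_of_unicyclic`). Removing a leaf at `a` leaves the same determinant
on the smaller set and its principal minor at `a`, and the latter is bounded by
`ConnectedOn.le_pminor_singleton`. If there is no leaf, the set is an odd cycle, and replacing a
path of three edges by one edge shortens it by two (`det_add_path`,
`ConnectedOn.le_pminor_of_two_regular`) until a triangle remains. All minors are estimated by adding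
vertices one at a time and discarding unneeded edges, which can only lower a determinant. When a new
vertex sees both colors of a bipartite set, the sign of an entry of the inverse matrix is needed
(`inv_groundedMatrix_apply_nonpos`).

Each estimate is strict unless some vertex is adjacent to all others. A dominating vertex together
with non-bipartiteness and the edge count forces the extremal graph (`IsUnicyclic.nonempty_iso`). -/

/-! ### Determinants under rank one perturbations. -/

namespace Matrix

variable {V : Type*} [Fintype V] [DecidableEq V]

/-- The matrix obtained from `K` by replacing the rows and columns indexed by `R` by those of the
identity matrix; its determinant is the principal minor of `K` on the complement of `R`. -/
def ground (K : Matrix V V ℝ) (R : Finset V) : Matrix V V ℝ :=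
  Matrix.of fun i j => if i ∈ R ∨ j ∈ R then (1 : Matrix V V ℝ) i j else K i j

/-- The rank one matrix `w wᵀ`. -/
abbrev outerSq {W : Type*} (w : W → ℝ) : Matrix W W ℝ := vecMulVec w w

theorem posSemidef_outerSq {W : Type*} [Finite W] (w : W → ℝ) : (outerSq w).PosSemidef := by
  simpa using posSemidef_vecMulVec_self_star w

/-- The matrix determinant lemma for a symmetric rank one term. -/
theorem det_add_smul_outerSq {K : Matrix V V ℝ} (hK : K.PosDef) (t : ℝ) (w : V → ℝ) :
    (K + t • outerSq w).det = K.det * (1 + t * (w ⬝ᵥ K⁻¹ *ᵥ w)) := by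
  have h := det_add_replicateCol_mul_replicateRow (ι := Unit)
    ((isUnit_iff_isUnit_det K).1 hK.isUnit) (t • w) w
  rw [← vecMulVec_eq, smul_vecMulVec] at h
  rw [outerSq, h]
  congr 2
  simp [replicateRow, replicateCol, mul_apply, dotProduct, mulVec, Finset.mul_sum,
    Finset.sum_mul, det_unique]
  rw [Finset.sum_comm]
  exact Finset.sum_congr rfl fun i _ => Finset.sum_congr rfl fun j _ => by ring

theorem det_le_det_add_smul_outerSq {K : Matrix V V ℝ} (hK : K.PosDef) {t : ℝ} (ht : 0 ≤ t)
    (w : V → ℝ) : K.det ≤ (K + t • outerSq w).det := by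
  rw [det_add_smul_outerSq hK]
  have h1 := hK.inv.posSemidef.dotProduct_mulVec_nonneg w
  have h2 := hK.det_pos
  simp only [star_trivial] at h1
  nlinarith [mul_nonneg ht h1]

theorem PosDef.add_smul_outerSq {W : Type*} [Finite W] {K : Matrix W W ℝ} (hK : K.PosDef) {t : ℝ}
    (ht : 0 ≤ t) (w : W → ℝ) : (K + t • outerSq w).PosDef :=
  hK.add_posSemidef ((posSemidef_outerSq w).smul ht)

theorem det_le_det_add_sum_smul_outerSq {ι : Type*} {K : Matrix V V ℝ} (hK : K.PosDef) {t : ℝ}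
    (ht : 0 ≤ t) (w : ι → V → ℝ) (s : Finset ι) :
    K.det ≤ (K + ∑ i ∈ s, t • outerSq (w i)).det ∧ (K + ∑ i ∈ s, t • outerSq (w i)).PosDef := by
  classical
  induction s using Finset.induction_on with
  | empty => simpa using hK
  | insert a s ha ih =>
    rw [Finset.sum_insert ha, add_comm (t • outerSq (w a)), ← add_assoc]
    exact ⟨ih.1.trans (det_le_det_add_smul_outerSq ih.2 ht _), ih.2.add_smul_outerSq ht _⟩

theorem det_ground_singleton (K : Matrix V V ℝ) (a : V) :
    (K.ground {a}).det = (K.updateRow a (Pi.single a 1)).det := by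
  refine det_eq_of_forall_row_eq_smul_add_const (fun i => if i = a then 0 else -K i a) a
    (by simp) fun i j => ?_
  by_cases hi : i = a
  · subst hi
    simp [ground, one_apply, Pi.single_apply, eq_comm]
  · by_cases hj : j = a
    · subst hj
      simp [ground, one_apply, hi]
    · simp [ground, hi, hj]

theorem det_add_smul_single (K : Matrix V V ℝ) (a : V) (s : ℝ) :
    (K + s • single a a 1).det = K.det + s * (K.ground {a}).det := by
  have : K + s • single a a 1 = K.updateRow a (K a + s • Pi.single a 1) := by
    ext i j
    by_cases hi : i = a
    · subst hi
      simp [single, Pi.single_apply, eq_comm]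
    · simp [single, hi, Ne.symm hi]
  rw [this, det_updateRow_add, det_updateRow_smul, updateRow_eq_self, det_ground_singleton]

/-- The determinant of a perturbation supported on few coordinates. -/
theorem det_add_of_submatrix {m : ℕ} {K : Matrix V V ℝ} (hK : K.PosDef) (p : Fin m → V)
    (C : Matrix (Fin m) (Fin m) ℝ) :
    (K + (1 : Matrix V V ℝ).submatrix id p * C * (1 : Matrix V V ℝ).submatrix p id).det =
      K.det * (1 + C * K⁻¹.submatrix p p).det := by
  rw [Matrix.mul_assoc, det_add_mul _ _ ((isUnit_iff_isUnit_det K).1 hK.isUnit), Matrix.mul_assoc,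
    Matrix.mul_assoc]
  congr 4
  rw [← Matrix.mul_assoc]
  ext i j
  simp [mul_apply, one_apply]

theorem submatrix_one_mul_outerSq_mul {W : Type*} [DecidableEq W] {m : ℕ} (p : Fin m → W)
    (c : Fin m → ℝ) :
    (1 : Matrix W W ℝ).submatrix id p * outerSq c * (1 : Matrix W W ℝ).submatrix p id =
      outerSq (∑ k, c k • Pi.single (p k) 1) := by
  ext i j
  simp [mul_apply, vecMulVec_apply, one_apply, Finset.sum_mul, Finset.mul_sum, Pi.single_apply]
  exact Finset.sum_congr rfl fun x _ => by simp only [eq_comm (a := j)]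

theorem single_eq_outerSq {W : Type*} [DecidableEq W] (a : W) :
    single a a (1 : ℝ) = outerSq (Pi.single a 1) := by
  ext i j
  simp [single, vecMulVec_apply, Pi.single_apply, eq_comm]
  grind

/-- The determinant of `K + e_a e_aᵀ` is computed twice, by linearity in row `a` and by the rank one
formula. With `det_ground_pair_eq`, this turns minors into entries of `K⁻¹`, so that the identities
below become small explicit determinants. -/
theorem det_ground_singleton_eq {K : Matrix V V ℝ} (hK : K.PosDef) (a : V) :
    (K.ground {a}).det = K.det * K⁻¹ a a := by
  have h1 := det_add_smul_single K a 1
  have h2 := det_add_smul_outerSq hK 1 (Pi.single a 1)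
  rw [← single_eq_outerSq] at h2
  simp at h1 h2
  linarith

theorem det_add_two_outerSq {m : ℕ} {K : Matrix V V ℝ} (hK : K.PosDef) (p : Fin m → V) (t : ℝ)
    (c d : Fin m → ℝ) :
    (K + t • outerSq (∑ k, c k • Pi.single (p k) 1) +
      t • outerSq (∑ k, d k • Pi.single (p k) 1)).det =
      K.det * (1 + (t • outerSq c + t • outerSq d) * K⁻¹.submatrix p p).det := by
  rw [← det_add_of_submatrix hK]
  simp only [← submatrix_one_mul_outerSq_mul, Matrix.mul_add, Matrix.add_mul, Matrix.mul_smul,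
    Matrix.smul_mul, add_assoc]

theorem det_add_three_outerSq {m : ℕ} {K : Matrix V V ℝ} (hK : K.PosDef) (p : Fin m → V)
    (t : ℝ) (c d e : Fin m → ℝ) :
    (K + t • outerSq (∑ k, c k • Pi.single (p k) 1) + t • outerSq (∑ k, d k • Pi.single (p k) 1) +
        t • outerSq (∑ k, e k • Pi.single (p k) 1)).det =
      K.det * (1 + (t • outerSq c + t • outerSq d + t • outerSq e) * K⁻¹.submatrix p p).det := by
  rw [← det_add_of_submatrix hK]
  simp only [← submatrix_one_mul_outerSq_mul, Matrix.mul_add, Matrix.add_mul, Matrix.mul_smul,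
    Matrix.smul_mul, add_assoc]

theorem PosDef.inv_apply_comm {K : Matrix V V ℝ} (hK : K.PosDef) (a b : V) :
    K⁻¹ b a = K⁻¹ a b := by
  simpa using hK.inv.isHermitian.apply a b

theorem det_ground_pair_eq {K : Matrix V V ℝ} (hK : K.PosDef) {a b : V} (hab : a ≠ b) :
    (K.ground {a, b}).det = K.det * (K⁻¹ a a * K⁻¹ b b - K⁻¹ a b ^ 2) := by
  have hg : (K + (1 : ℝ) • single b b 1).ground {a} = K.ground {a} + (1 : ℝ) • single b b 1 := by
    ext i j
    simp only [ground, single, Finset.mem_singleton, of_apply, add_apply, smul_apply, smul_eq_mul,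
      one_mul]
    split_ifs <;> grind
  have hg' : (K.ground {a}).ground {b} = K.ground {a, b} := by
    ext i j
    simp only [ground, Finset.mem_singleton, of_apply, Finset.mem_insert]
    split_ifs <;> grind
  have h1 := det_add_smul_single (K + (1 : ℝ) • single b b 1) a 1
  have h0 := det_add_smul_single K b 1
  rw [hg, det_add_smul_single (K.ground {a}), hg'] at h1
  have h2 := det_add_two_outerSq hK ![b, a] 1 ![1, 0] ![0, 1]
  have hs := hK.inv_apply_comm a b
  simp only [Fin.sum_univ_two, det_fin_two, mul_apply, vecMulVec_apply, add_apply,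
    submatrix_apply, one_apply, cons_val_zero, cons_val_one, hs, zero_smul, one_smul, add_zero,
    zero_add, ← single_eq_outerSq] at h2
  simp only [one_smul, one_mul] at h0 h1
  rw [h2, h0, det_ground_singleton_eq hK, det_ground_singleton_eq hK] at h1
  simp at h1
  linarith

section Isolated

variable {K : Matrix V V ℝ} (hK : K.PosDef) {t : ℝ} {v a b : V}
  (hv : ∀ j, K v j = (1 : Matrix V V ℝ) v j)

include hK hv

/-- In this section `v` is a vertex not yet joined to anything, so it also decouples in `K⁻¹`. The
lemmas that follow attach it by one or two edges; a loop stands for an edge to a grounded vertex. -/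
theorem inv_apply_of_row_eq_one (j : V) : K⁻¹ v j = (1 : Matrix V V ℝ) v j := by
  have h := congrFun (congrFun (mul_nonsing_inv K ((isUnit_iff_isUnit_det K).1 hK.isUnit)) v) j
  rw [← h, mul_apply]
  simp [hv, one_apply]

theorem det_add_loop : (K + t • outerSq (Pi.single v 1)).det = (1 + t) * K.det := by
  rw [det_add_smul_outerSq hK]
  simp [inv_apply_of_row_eq_one hK hv]
  ring

theorem det_add_edge (ha : a ≠ v) :
    (K + t • outerSq (Pi.single a 1 + Pi.single v 1)).det =
      (1 + t) * K.det + t * (K.ground {a}).det := by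
  have h2 : K⁻¹ v a = 0 := by simp [inv_apply_of_row_eq_one hK hv, ha.symm]
  have h1 : K⁻¹ a v = 0 := by rw [← h2, hK.inv_apply_comm]
  have h3 : K⁻¹ v v = 1 := by simp [inv_apply_of_row_eq_one hK hv]
  rw [det_add_smul_outerSq hK, det_ground_singleton_eq hK]
  simp [mulVec_add, h1, h2, h3]
  ring

theorem det_add_loop_add_edge (hb : b ≠ v) :
    (K + t • outerSq (Pi.single v 1) + t • outerSq (Pi.single b 1 + Pi.single v 1)).det =
      (1 + 2 * t) * K.det + (t + t ^ 2) * (K.ground {b}).det := by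
  have h2 : K⁻¹ v b = 0 := by simp [inv_apply_of_row_eq_one hK hv, hb.symm]
  have h1 : K⁻¹ b v = 0 := by rw [← h2, hK.inv_apply_comm]
  have h3 : K⁻¹ v v = 1 := by simp [inv_apply_of_row_eq_one hK hv]
  have h := det_add_two_outerSq hK ![v, b] t ![1, 0] ![1, 1]
  simp only [Fin.sum_univ_two, det_fin_two, mul_apply, vecMulVec_apply, add_apply, smul_apply,
    submatrix_apply, one_apply, cons_val_zero, cons_val_one, h1, h2, h3, zero_smul, one_smul,
    add_zero, smul_eq_mul] at h
  rw [det_ground_singleton_eq hK, add_comm (Pi.single b 1), h]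
  simp
  ring

/-- With `α, β, γ` the entries of `K⁻¹` at `aa, ab, bb`, the two sides differ by exactly `t² det K
(αγ - β² - 2β)`. Positive semidefiniteness gives `αγ - β² ≥ 0`, and the assumed sign of `β` does the
rest. -/
theorem det_add_edge_add_edge (ha : a ≠ v) (hb : b ≠ v)
    (hab : K⁻¹ a b ≤ 0) :
    (1 + 2 * t) * K.det + (t + t ^ 2) * ((K.ground {a}).det + (K.ground {b}).det) ≤
      (K + t • outerSq (Pi.single a 1 + Pi.single v 1) +
        t • outerSq (Pi.single b 1 + Pi.single v 1)).det := by
  have h2 : K⁻¹ v b = 0 := by simp [inv_apply_of_row_eq_one hK hv, hb.symm]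
  have h1 : K⁻¹ b v = 0 := by rw [← h2, hK.inv_apply_comm]
  have h4 : K⁻¹ v a = 0 := by simp [inv_apply_of_row_eq_one hK hv, ha.symm]
  have h5 : K⁻¹ a v = 0 := by rw [← h4, hK.inv_apply_comm]
  have h3 : K⁻¹ v v = 1 := by simp [inv_apply_of_row_eq_one hK hv]
  have hs := hK.inv_apply_comm a b
  have h := det_add_two_outerSq hK ![a, b, v] t ![1, 0, 1] ![0, 1, 1]
  simp only [Fin.sum_univ_three, det_fin_three, mul_apply, vecMulVec_apply, add_apply, smul_apply,
    submatrix_apply, one_apply, cons_val_zero, cons_val_one, cons_val, h1, h2, h3, h4, h5, hs,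
    zero_smul, one_smul, add_zero, zero_add, smul_eq_mul] at h
  have hq : 0 ≤ (K⁻¹ a a * K⁻¹ b b - K⁻¹ a b ^ 2) := by
    have h1 := (hK.inv.posSemidef.submatrix ![a, b]).det_nonneg
    simp only [det_fin_two, submatrix_apply, cons_val_zero, cons_val_one, hs] at h1
    linarith
  rw [h, det_ground_singleton_eq hK, det_ground_singleton_eq hK]
  simp
  have h6 := mul_nonneg (sq_nonneg t) (mul_nonneg hK.det_pos.le hq)
  have h7 := mul_nonneg (sq_nonneg t) (mul_nonneg hK.det_pos.le (neg_nonneg.2 hab))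
  nlinarith

end Isolated

/-- The inner vertices `x, y` decouple in `K⁻¹`, so everything reduces to a 4 × 4 determinant. Its
only term linear in `K⁻¹ x' y'` is `2 t³ K⁻¹ x' y'`, with the same sign as for a single edge `x'y'`:
a path of odd length may be replaced by an edge, and this fixes the coefficient `t²` of the first
term. -/
theorem det_add_path {K : Matrix V V ℝ} (hK : K.PosDef) {t : ℝ} {x' y' x y : V}
    (hx : ∀ j, K x j = (1 : Matrix V V ℝ) x j) (hy : ∀ j, K y j = (1 : Matrix V V ℝ) y j)
    (hxy : x ≠ y) (h₁ : x' ≠ x) (h₂ : x' ≠ y) (h₃ : y' ≠ x) (h₄ : y' ≠ y) (h₅ : x' ≠ y') :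
    (K + t • outerSq (Pi.single x 1 + Pi.single x' 1) + t • outerSq (Pi.single x 1 + Pi.single y 1) +
        t • outerSq (Pi.single y 1 + Pi.single y' 1)).det =
      t ^ 2 * (K + t • outerSq (Pi.single x' 1 + Pi.single y' 1)).det +
        (1 + 4 * t + 2 * t ^ 2) * K.det +
        (t + 3 * t ^ 2) * ((K.ground {x'}).det + (K.ground {y'}).det) +
        t ^ 2 * (1 + 2 * t) * (K.ground {x', y'}).det := by
  have e1 := inv_apply_of_row_eq_one hK hx
  have e2 := inv_apply_of_row_eq_one hK hy
  have hs := hK.inv_apply_comm x' y'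
  have h := det_add_three_outerSq hK ![x', y', x, y] t ![1, 0, 1, 0] ![0, 0, 1, 1] ![0, 1, 0, 1]
  have hH : K⁻¹.submatrix ![x', y', x, y] ![x', y', x, y] =
      !![K⁻¹ x' x', K⁻¹ x' y', 0, 0; K⁻¹ x' y', K⁻¹ y' y', 0, 0; 0, 0, 1, 0; 0, 0, 0, 1] := by
    ext i j
    fin_cases i <;> fin_cases j <;>
      simp [e1, e2, hs, hK.inv_apply_comm x _, hK.inv_apply_comm y _, hxy, hxy.symm,
        h₁.symm, h₂.symm, h₃.symm, h₄.symm]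
  have hC : t • outerSq ![1, 0, 1, 0] + t • outerSq ![0, 0, 1, 1] + t • outerSq ![0, 1, 0, 1] =
      !![t, 0, t, 0; 0, t, 0, t; t, 0, 2 * t, t; (0 : ℝ), t, t, 2 * t] := by
    ext i j
    fin_cases i <;> fin_cases j <;> simp <;> ring
  have hw : ∀ c : Fin 4 → ℝ, ∑ k, c k • Pi.single (![x', y', x, y] k) (1 : ℝ) =
      c 0 • Pi.single x' 1 + c 1 • Pi.single y' 1 + c 2 • Pi.single x 1 + c 3 • Pi.single y 1 := by
    intro c
    simp [Fin.sum_univ_four]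
  have hM : (1 + !![t, 0, t, 0; 0, t, 0, t; t, 0, 2 * t, t; (0 : ℝ), t, t, 2 * t] *
      !![K⁻¹ x' x', K⁻¹ x' y', 0, 0; K⁻¹ x' y', K⁻¹ y' y', 0, 0; 0, 0, 1, 0; 0, 0, 0, 1]) =
      !![1 + t * K⁻¹ x' x', t * K⁻¹ x' y', t, 0; t * K⁻¹ x' y', 1 + t * K⁻¹ y' y', 0, t;
        t * K⁻¹ x' x', t * K⁻¹ x' y', 1 + 2 * t, t;
        t * K⁻¹ x' y', t * K⁻¹ y' y', t, 1 + 2 * t] := by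
    ext i j
    fin_cases i <;> fin_cases j <;> simp
  rw [hH, hC, hM] at h
  simp only [hw] at h
  simp only [cons_val, zero_smul, one_smul, add_zero, zero_add] at h
  rw [add_comm (Pi.single x 1) (Pi.single x' 1), add_comm (Pi.single y 1) (Pi.single y' 1), h,
    det_ground_pair_eq hK h₅, det_ground_singleton_eq hK, det_ground_singleton_eq hK,
    det_add_smul_outerSq hK]
  simp [det_succ_row_zero, Fin.sum_univ_succ, mulVec_add, Fin.succAbove, hs]
  ring

theorem det_one_add_triangle {t : ℝ} {x y z : V} (hxy : x ≠ y) (hxz : x ≠ z)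
    (hyz : y ≠ z) :
    ((1 : Matrix V V ℝ) + t • outerSq (Pi.single x 1 + Pi.single z 1) +
        t • outerSq (Pi.single x 1 + Pi.single y 1) + t • outerSq (Pi.single y 1 + Pi.single z 1)).det =
      (1 + t) ^ 2 * (1 + 4 * t) := by
  have h := det_add_three_outerSq (K := (1 : Matrix V V ℝ)) PosDef.one ![x, y, z] t
    ![1, 0, 1] ![1, 1, 0] ![0, 1, 1]
  simp only [Fin.sum_univ_three, det_fin_three, mul_apply, vecMulVec_apply, add_apply, smul_apply,
    submatrix_apply, one_apply, cons_val, zero_smul, one_smul, add_zero, zero_add, smul_eq_mul,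
    inv_one, hxy, hxz, hyz, hxy.symm, hxz.symm, hyz.symm, if_true, if_false] at h
  rw [h]
  simp
  ring

end Matrix

/-! ### Principal minors of `1 + t Q` on vertex subsets. -/

open Matrix

namespace SimpleGraph

section PrincipalMinor

variable {V : Type*} [DecidableEq V]

/-- The column of the incidence matrix at the edge `ij`, with the coordinates in `R` erased. -/
def edgeVec (R : Finset V) (i j : V) : V → ℝ :=
  fun k => if k ∈ R then 0 else (Pi.single i 1 + Pi.single j 1 : V → ℝ) k

theorem edgeVec_comm (R : Finset V) (i j : V) : edgeVec R i j = edgeVec R j i := by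
  ext k
  simp only [edgeVec, Pi.add_apply]
  rw [add_comm]

theorem edgeVec_of_notMem {R : Finset V} {i j : V} (hi : i ∉ R) (hj : j ∉ R) :
    edgeVec R i j = Pi.single i 1 + Pi.single j 1 := by
  ext k
  simp only [edgeVec, Pi.add_apply, Pi.single_apply]
  grind

theorem edgeVec_of_mem {R : Finset V} {i j : V} (hi : i ∈ R) (hj : j ∉ R) :
    edgeVec R i j = Pi.single j 1 := by
  ext k
  simp only [edgeVec, Pi.add_apply, Pi.single_apply]
  grind

variable (G : SimpleGraph V) [DecidableRel G.Adj]

/-- The matrix `1 + t Q`, where `Q` is the signless Laplacian matrix of the subgraph of `G` induced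
on `S`, padded by zeros, and with the rows and columns in `R` replaced by zeros. -/
noncomputable def groundedMatrix (t : ℝ) (S R : Finset V) : Matrix V V ℝ :=
  1 + ∑ p ∈ (S ×ˢ S).filter (fun p => G.Adj p.1 p.2), (t / 2) • outerSq (edgeVec R p.1 p.2)

variable {G} {t : ℝ} {S R : Finset V} {v a b : V}

/-- The weight `t / 2` in the definition compensates for each edge occurring as two ordered pairs;
here each new edge occurs once, with weight `t`. -/
theorem groundedMatrix_insert (hv : v ∉ S) :
    G.groundedMatrix t (insert v S) R =
      G.groundedMatrix t S R + ∑ a ∈ S.filter (G.Adj v), t • outerSq (edgeVec R a v) := by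
  simp only [groundedMatrix, Finset.sum_filter, Finset.sum_product, Finset.sum_insert hv,
    Finset.sum_add_distrib, G.irrefl, if_false, add_assoc, zero_add]
  have h1 : ∀ x, (if G.Adj x v then (t / 2) • outerSq (edgeVec R x v) else 0) =
      (if G.Adj v x then (t / 2) • outerSq (edgeVec R v x) else 0) := by
    intro x
    simp only [G.adj_comm x v, edgeVec_comm R x v]
  have h2 : ∀ x, (if G.Adj v x then t • outerSq (edgeVec R x v) else 0) =
      (if G.Adj v x then (t / 2) • outerSq (edgeVec R v x) else 0) +
      (if G.Adj v x then (t / 2) • outerSq (edgeVec R v x) else 0) := by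
    intro x
    split_ifs
    · rw [edgeVec_comm, ← add_smul, add_halves]
    · simp
  simp only [h1, h2, Finset.sum_add_distrib]
  abel

theorem groundedMatrix_apply_of_notMem (hv : v ∉ S) (j : V) :
    G.groundedMatrix t S R v j = (1 : Matrix V V ℝ) v j := by
  rw [groundedMatrix, Matrix.add_apply, Matrix.sum_apply, Finset.sum_eq_zero, add_zero]
  intro p hp
  simp only [Finset.mem_filter, Finset.mem_product] at hp
  have h1 : v ≠ p.1 := fun h => hv (h ▸ hp.1.1)
  have h2 : v ≠ p.2 := fun h => hv (h ▸ hp.1.2)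
  simp [vecMulVec_apply, edgeVec, h1, h2]

/-- Passing to a minor keeps the form identity plus rank one terms, so minors obey the same
monotonicity as the full determinant. -/
theorem ground_groundedMatrix (R' : Finset V) :
    (G.groundedMatrix t S R).ground R' = G.groundedMatrix t S (R' ∪ R) := by
  ext i j
  by_cases h : i ∈ R' ∨ j ∈ R'
  · rw [ground, of_apply, if_pos h, groundedMatrix, Matrix.add_apply, Matrix.sum_apply,
      Finset.sum_eq_zero, add_zero]
    intro p _
    rcases h with h | h <;> simp [h, vecMulVec_apply, edgeVec]
  · rw [ground, of_apply, if_neg h]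
    push Not at h
    simp [groundedMatrix, Matrix.sum_apply, vecMulVec_apply, edgeVec, h.1, h.2]

variable [Fintype V]

variable (G) in
/-- The principal minor, complementary to `R`, of `1 + t Q`, where `Q` is the signless Laplacian
matrix of the subgraph of `G` induced on `S`. -/
noncomputable def pminor (t : ℝ) (S R : Finset V) : ℝ := (G.groundedMatrix t S R).det

theorem posDef_groundedMatrix (ht : 0 ≤ t) (S R : Finset V) : (G.groundedMatrix t S R).PosDef :=
  (det_le_det_add_sum_smul_outerSq PosDef.one (by positivity) _ _).2

theorem pminor_pos (ht : 0 ≤ t) (S R : Finset V) : 0 < G.pminor t S R :=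
  (posDef_groundedMatrix ht S R).det_pos

/-- Only the edges from `v` to the chosen set `T` are kept; dropping the others cannot raise the
determinant. All the one-step bounds below come from a `T` with at most two elements. -/
theorem pminor_le_pminor_insert (ht : 0 ≤ t) (hv : v ∉ S) {T : Finset V}
    (hT : T ⊆ S.filter (G.Adj v)) :
    (G.groundedMatrix t S R + ∑ a ∈ T, t • outerSq (edgeVec R a v)).det ≤
      G.pminor t (insert v S) R := by
  rw [pminor, groundedMatrix_insert hv, ← Finset.sum_sdiff hT, add_comm (∑ a ∈ _ \ _, _),
    ← add_assoc]
  exact (det_le_det_add_sum_smul_outerSq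
    (det_le_det_add_sum_smul_outerSq (posDef_groundedMatrix ht S R) ht _ T).2 ht _ _).1

theorem pminor_le_insert (ht : 0 ≤ t) (hv : v ∉ S) :
    G.pminor t S R ≤ G.pminor t (insert v S) R := by
  simpa [pminor] using pminor_le_pminor_insert (G := G) (R := R) ht hv (Finset.empty_subset _)

theorem pminor_insert_ge_of_notMem (ht : 0 ≤ t) (hv : v ∉ S) (hvR : v ∉ R) (ha : a ∈ S)
    (haR : a ∉ R) (hva : G.Adj v a) :
    (1 + t) * G.pminor t S R + t * G.pminor t S (insert a R) ≤ G.pminor t (insert v S) R := by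
  refine le_trans (le_of_eq ?_) (pminor_le_pminor_insert ht hv
    (T := {a}) (by simpa using ⟨ha, hva⟩))
  rw [Finset.sum_singleton, edgeVec_of_notMem haR hvR, det_add_edge (posDef_groundedMatrix ht S R)
    (groundedMatrix_apply_of_notMem hv) hva.ne', ground_groundedMatrix, Finset.singleton_union]
  rfl

theorem pminor_insert_ge (ht : 0 ≤ t) (hv : v ∉ S) (hvR : v ∉ R) (ha : a ∈ S)
    (hva : G.Adj v a) : (1 + t) * G.pminor t S R ≤ G.pminor t (insert v S) R := by
  by_cases haR : a ∈ R
  · refine le_trans (le_of_eq ?_) (pminor_le_pminor_insert ht hv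
      (T := {a}) (by simpa using ⟨ha, hva⟩))
    rw [Finset.sum_singleton, edgeVec_of_mem haR hvR, det_add_loop (posDef_groundedMatrix ht S R)
      (groundedMatrix_apply_of_notMem hv)]
    rfl
  · have h := pminor_insert_ge_of_notMem ht hv hvR ha haR hva
    nlinarith [mul_nonneg ht (pminor_pos (G := G) ht S (insert a R)).le]

theorem pminor_insert_ge_of_mem_of_notMem (ht : 0 ≤ t) (hv : v ∉ S) (hvR : v ∉ R) (ha : a ∈ S)
    (haR : a ∈ R) (hva : G.Adj v a) (hb : b ∈ S) (hbR : b ∉ R) (hvb : G.Adj v b) :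
    (1 + 2 * t) * G.pminor t S R + (t + t ^ 2) * G.pminor t S (insert b R) ≤
      G.pminor t (insert v S) R := by
  have hab : a ≠ b := fun h => hbR (h ▸ haR)
  refine le_trans (le_of_eq ?_) (pminor_le_pminor_insert ht hv (T := {a, b}) ?_)
  · rw [Finset.sum_pair hab, edgeVec_of_mem haR hvR, edgeVec_of_notMem hbR hvR, ← add_assoc,
      det_add_loop_add_edge (posDef_groundedMatrix ht S R)
      (groundedMatrix_apply_of_notMem hv) hvb.ne', ground_groundedMatrix, Finset.singleton_union]
    rfl
  · grind

theorem dotProduct_groundedMatrix_mulVec (z : V → ℝ) :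
    z ⬝ᵥ G.groundedMatrix t S R *ᵥ z = z ⬝ᵥ z +
      ∑ p ∈ (S ×ˢ S).filter (fun p => G.Adj p.1 p.2),
        t / 2 * ((if p.1 ∈ R then 0 else z p.1) + (if p.2 ∈ R then 0 else z p.2)) ^ 2 := by
  rw [groundedMatrix, add_mulVec, dotProduct_add, one_mulVec, sum_mulVec, dotProduct_sum]
  congr 1
  refine Finset.sum_congr rfl fun p _ => ?_
  have h : z ⬝ᵥ edgeVec R p.1 p.2 =
      (if p.1 ∈ R then 0 else z p.1) + (if p.2 ∈ R then 0 else z p.2) := by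
    have h1 : ∀ k, z k * edgeVec R p.1 p.2 k =
        (if p.1 = k then (if k ∈ R then 0 else z k) else 0) +
        (if p.2 = k then (if k ∈ R then 0 else z k) else 0) := by
      intro k
      simp only [edgeVec, Pi.add_apply, Pi.single_apply]
      split_ifs <;> grind
    simp only [dotProduct, h1, Finset.sum_add_distrib, Finset.sum_ite_eq, Finset.mem_univ, if_true]
  rw [smul_mulVec, dotProduct_smul, vecMulVec_mulVec, dotProduct_smul, smul_eq_mul, ← h,
    dotProduct_comm (edgeVec R p.1 p.2), sq]
  simp

/-- In a bipartite graph, the entries of the inverse of the grounded matrix are nonpositive at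
pairs of vertices of different colors. -/
theorem inv_groundedMatrix_apply_nonpos (ht : 0 ≤ t) (c : V → Bool)
    (hc : ∀ i ∈ S, ∀ j ∈ S, G.Adj i j → c i ≠ c j) (hab : c a ≠ c b) :
    (G.groundedMatrix t S R)⁻¹ a b ≤ 0 := by
  have hK := posDef_groundedMatrix (G := G) ht S R
  set K := G.groundedMatrix t S R with hKdef
  set x : V → ℝ := K⁻¹ *ᵥ Pi.single b 1 with hx
  -- The competitor `y` has the absolute values of `x`, but is nonnegative on the color of `b` and
  -- nonpositive on the other. Every edge joins different colors, so each edge term of the quadratic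
  -- form can only shrink.
  set y : V → ℝ := fun i => if c i = c b then |x i| else -|x i| with hy
  have hKx : K *ᵥ x = Pi.single b 1 := by
    rw [hx, mulVec_mulVec, mul_nonsing_inv K ((isUnit_iff_isUnit_det K).1 hK.isUnit), one_mulVec]
  have hq : y ⬝ᵥ K *ᵥ y ≤ x ⬝ᵥ K *ᵥ x := by
    rw [hKdef, dotProduct_groundedMatrix_mulVec, dotProduct_groundedMatrix_mulVec]
    refine add_le_add (le_of_eq ?_) (Finset.sum_le_sum fun p hp => ?_)
    · refine Finset.sum_congr rfl fun i _ => ?_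
      simp only [hy]
      split_ifs <;> simp
    · simp only [Finset.mem_filter, Finset.mem_product] at hp
      have hcp := hc _ hp.1.1 _ hp.1.2 hp.2
      refine mul_le_mul_of_nonneg_left ?_ (by positivity)
      rw [sq_le_sq]
      have hcp' : (c p.1 = c b ∧ c p.2 ≠ c b) ∨ (c p.1 ≠ c b ∧ c p.2 = c b) := by
        cases h1 : c p.1 <;> cases h2 : c p.2 <;> cases h3 : c b <;> simp_all
      rcases hcp' with ⟨h1, h2⟩ | ⟨h1, h2⟩ <;> simp only [hy, h1, h2, if_true, if_false] <;>
        split_ifs <;> simp <;> rw [abs_le] <;> constructor <;>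
          cases abs_cases (x p.1) <;> cases abs_cases (x p.2) <;>
            cases abs_cases (x p.1 + x p.2) <;> linarith
  have hyb : x b ≤ y b := by
    simp only [hy, if_true]
    exact le_abs_self _
  have hsymm : x ⬝ᵥ K *ᵥ y = y b := by
    rw [dotProduct_mulVec, ← mulVec_transpose]
    have : K.IsSymm := by simpa using hK.isHermitian
    rw [this.eq, hKx]
    simp
  -- `x` is the unique minimizer of `zᵀ K z - 2 z_b`, and `y` does at least as well; hence `y = x`,
  -- and `x a` carries the sign prescribed by the coloring.
  have hzero : (y - x) ⬝ᵥ K *ᵥ (y - x) ≤ 0 := by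
    rw [mulVec_sub, sub_dotProduct, dotProduct_sub, dotProduct_sub, hsymm]
    rw [hKx] at hq ⊢
    simp only [dotProduct_single, mul_one] at hq ⊢
    linarith
  have hxy : y - x = 0 := by
    by_contra hne
    have := hK.dotProduct_mulVec_pos hne
    simp only [star_trivial] at this
    linarith
  have : K⁻¹ a b = x a := by simp [hx]
  rw [this, ← sub_eq_zero.1 hxy]
  simp [hy, hab]

theorem pminor_insert_ge_of_ne_color (ht : 0 ≤ t) (hv : v ∉ S) (hvR : v ∉ R)
    (c : V → Bool) (hc : ∀ i ∈ S, ∀ j ∈ S, G.Adj i j → c i ≠ c j) (hab : c a ≠ c b)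
    (ha : a ∈ S) (haR : a ∉ R) (hva : G.Adj v a) (hb : b ∈ S) (hbR : b ∉ R) (hvb : G.Adj v b) :
    (1 + 2 * t) * G.pminor t S R +
        (t + t ^ 2) * (G.pminor t S (insert a R) + G.pminor t S (insert b R)) ≤
      G.pminor t (insert v S) R := by
  have hne : a ≠ b := fun h => hab (h ▸ rfl)
  refine le_trans ?_ (pminor_le_pminor_insert ht hv (T := {a, b}) (by grind))
  rw [Finset.sum_pair hne, edgeVec_of_notMem haR hvR, edgeVec_of_notMem hbR hvR, ← add_assoc]
  refine le_trans (le_of_eq ?_) (det_add_edge_add_edge (posDef_groundedMatrix ht S R)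
    (groundedMatrix_apply_of_notMem hv) hva.ne' hvb.ne'
    (inv_groundedMatrix_apply_nonpos ht c hc hab))
  simp only [ground_groundedMatrix, Finset.singleton_union]
  rfl

variable (G) in
theorem signlessLapMatrix_eq_sum :
    G.signlessLapMatrix = ∑ p ∈ (Finset.univ ×ˢ Finset.univ).filter
      (fun p : V × V => G.Adj p.1 p.2), (1 / 2 : ℝ) • outerSq (edgeVec ∅ p.1 p.2) := by
  symm
  ext i j
  simp only [Finset.sum_filter, Finset.sum_product, Matrix.sum_apply, 
    Matrix.smul_apply, vecMulVec_apply, edgeVec, Finset.notMem_empty, if_false, Pi.add_apply,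
    signlessLapMatrix, Matrix.add_apply, degMatrix, adjMatrix_apply,
    smul_eq_mul]
  have hd : ∀ i, ∑ x, (if G.Adj i x then (1 : ℝ) else 0) = G.degree i := by
    intro i
    simp [← G.card_neighborFinset_eq_degree, neighborFinset_eq_filter]
  have hd' : ∀ i, ∑ x, (if G.Adj x i then (1 : ℝ) else 0) = G.degree i := by
    intro i
    simp only [G.adj_comm _ i, hd]
  -- The outer product of an incidence column splits into four indicators: two sum to the degree on
  -- the diagonal, two to the adjacency entry.
  have hs : ∀ x y, (if G.Adj x y then 1 / 2 * (((Pi.single x 1 : V → ℝ) i +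
      (Pi.single y 1 : V → ℝ) i) * ((Pi.single x 1 : V → ℝ) j + (Pi.single y 1 : V → ℝ) j))
      else 0) =
      (if i = x then (if j = x then (1 / 2) * (if G.Adj x y then 1 else 0) else 0) else 0) +
      (if i = x then (if j = y then (1 / 2) * (if G.Adj x y then 1 else 0) else 0) else 0) +
      (if j = x then (if i = y then (1 / 2) * (if G.Adj x y then 1 else 0) else 0) else 0) +
      (if i = y then (if j = y then (1 / 2) * (if G.Adj x y then 1 else 0) else 0) else 0) := by
    intro x y
    simp only [Pi.single_apply]
    split_ifs <;> simp_all
  simp only [one_div] at hs ⊢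
  simp only [hs, Finset.sum_add_distrib, Finset.sum_ite_eq,
    Finset.sum_ite_irrel, Finset.mem_univ, if_true, Finset.sum_const_zero, ← Finset.mul_sum, hd, hd']
  simp only [G.adj_comm j i, diagonal_apply, eq_comm (a := j)]
  split_ifs with h1 h2 <;> norm_num
  · exact (G.ne_of_adj h2 h1).elim
  · ring

theorem groundedMatrix_univ : G.groundedMatrix t Finset.univ ∅ = 1 + t • G.signlessLapMatrix := by
  rw [signlessLapMatrix_eq_sum, groundedMatrix, Finset.smul_sum]
  congr 1
  refine Finset.sum_congr rfl fun p _ => ?_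
  rw [smul_smul]
  congr 1
  ring

variable (G) in
theorem posSemidef_signlessLapMatrix : G.signlessLapMatrix.PosSemidef := by
  rw [signlessLapMatrix_eq_sum]
  exact posSemidef_sum _ fun p _ => (posSemidef_outerSq _).smul (by norm_num)

end PrincipalMinor

end SimpleGraph

/-! ### Connected vertex sets grown one vertex at a time, and first bounds on their minors. -/

namespace SimpleGraph

variable {V : Type*} [DecidableEq V] (G : SimpleGraph V)

/-- The finite set `S` of vertices is nonempty and every cut of it is crossed by an edge of `G`. -/
def ConnectedOn (S : Finset V) : Prop :=
  S.Nonempty ∧ ∀ T ⊆ S, T.Nonempty → T ≠ S → ∃ a ∈ T, ∃ b ∈ S, b ∉ T ∧ G.Adj a b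

/-- The set `S` arises from `{u}` by successively adding a vertex with an earlier neighbor. -/
inductive Grows (u : V) : Finset V → Prop
  | singleton : Grows u {u}
  | insert {S : Finset V} {v a : V} (hS : Grows u S) (hv : v ∉ S) (ha : a ∈ S)
      (hva : G.Adj v a) : Grows u (insert v S)

variable {G} {S : Finset V} {u v w a : V}

theorem Grows.mem (h : G.Grows u S) : u ∈ S := by
  induction h with
  | singleton => simp
  | insert _ _ _ _ ih => exact Finset.mem_insert_of_mem ih

theorem ConnectedOn.grows (h : G.ConnectedOn S) (hu : u ∈ S) : G.Grows u S := by
  -- Induction on the number of vertices of `S` not yet reached; an edge leaving `T` supplies the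
  -- next one.
  suffices H : ∀ k, ∀ T ⊆ S, G.Grows u T → (S \ T).card = k → G.Grows u S from
    H _ {u} (by simpa) .singleton rfl
  intro k
  induction k with
  | zero =>
    intro T hT hg hc
    rw [Finset.card_eq_zero, Finset.sdiff_eq_empty_iff_subset] at hc
    rwa [hc.antisymm hT]
  | succ k ih =>
    intro T hT hg hc
    have hne : T ≠ S := by
      rintro rfl
      simp at hc
    obtain ⟨a, ha, b, hb, hbT, hab⟩ := h.2 T hT ⟨u, hg.mem⟩ hne
    refine ih _ (Finset.insert_subset hb hT) (hg.insert hbT ha hab.symm) ?_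
    rw [Finset.sdiff_insert, Finset.card_erase_of_mem (by simp [hb, hbT]), hc]
    rfl

theorem Grows.connectedOn (h : G.Grows u S) : G.ConnectedOn S := by
  induction h with
  | singleton =>
    refine ⟨by simp, fun T hT hne hT' => ?_⟩
    rcases Finset.subset_singleton_iff.1 hT with h | h
    · simp [h] at hne
    · exact (hT' h).elim
  | @insert S v a hS hv ha hva ih =>
    refine ⟨by simp, fun T hT hne hT' => ?_⟩
    by_cases hTS : T ∩ S = ∅
    · have : T = {v} := by
        refine Finset.Nonempty.subset_singleton_iff hne |>.1 fun x hx => ?_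
        have := hT hx
        have h2 : x ∉ T ∩ S := by simp [hTS]
        grind
      exact ⟨v, by simp [this], a, by simp [ha], by rw [this]; simpa using hva.ne', hva⟩
    by_cases hTS' : T ∩ S = S
    · have hvT : v ∉ T := by
        intro hvT
        apply hT'
        refine hT.antisymm (Finset.insert_subset hvT ?_)
        rw [← hTS']
        exact Finset.inter_subset_left
      have : a ∈ T := by
        rw [← hTS'] at ha
        exact (Finset.mem_inter.1 ha).1
      exact ⟨a, this, v, by simp, hvT, hva.symm⟩
    · obtain ⟨x, hx, y, hy, hyT, hxy⟩ := ih.2 (T ∩ S) Finset.inter_subset_right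
        (Finset.nonempty_iff_ne_empty.2 hTS) hTS'
      exact ⟨x, by grind, y, by grind, by grind, hxy⟩

/-- Removing a vertex with a single neighbor keeps a set connected. -/
theorem ConnectedOn.of_insert (h : G.ConnectedOn (insert v S)) (hv : v ∉ S) (ha : a ∈ S)
    (huniq : ∀ b ∈ S, G.Adj v b → b = a) : G.ConnectedOn S := by
  refine ⟨⟨a, ha⟩, fun T hT hne hT' => ?_⟩
  by_cases haT : a ∈ T
  · obtain ⟨x, hx, y, hy, hyT, hxy⟩ := h.2 (insert v T) (Finset.insert_subset_insert v hT)
      (by simp) (fun he => hT' (by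
        have := congrArg (fun s => Finset.erase s v) he
        rwa [Finset.erase_insert hv, Finset.erase_insert (fun h => hv (hT h))] at this))
    rcases Finset.mem_insert.1 hx with rfl | hx
    · have : y ∈ S := by grind
      have := huniq y this hxy
      grind
    · exact ⟨x, hx, y, by grind, by grind, hxy⟩
  · obtain ⟨x, hx, y, hy, hyT, hxy⟩ := h.2 T (hT.trans (Finset.subset_insert v S)) hne (by grind)
    rcases Finset.mem_insert.1 hy with rfl | hy
    · have := huniq x (hT hx) hxy.symm
      grind
    · exact ⟨x, hx, y, hy, hyT, hxy⟩

theorem Connected.connectedOn_univ [Fintype V] (h : G.Connected) :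
    G.ConnectedOn Finset.univ := by
  have := h.nonempty
  refine ⟨Finset.univ_nonempty, fun T _ ⟨x, hx⟩ hT => ?_⟩
  obtain ⟨y, hy⟩ : ∃ y, y ∉ T := by
    by_contra! hh
    exact hT (Finset.eq_univ_of_forall hh)
  obtain ⟨p⟩ := h.preconnected x y
  obtain ⟨d, _, h1, h2⟩ := p.exists_boundary_dart (T : Set V) (by simpa) (by simpa)
  exact ⟨d.fst, by simpa using h1, d.snd, by simp, by simpa using h2, d.adj⟩

variable (G) in
/-- No proper coloring of the subgraph induced on `S` uses two colors. -/
def NotBipartiteOn (S : Finset V) : Prop :=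
  ∀ c : V → Bool, ∃ i ∈ S, ∃ j ∈ S, G.Adj i j ∧ c i = c j

/-- A proper coloring of `S` would extend to `v` by the color opposite to that of `a`, its only
possible neighbor in `S`. -/
theorem NotBipartiteOn.of_insert (h : G.NotBipartiteOn (insert v S)) (hv : v ∉ S)
    (huniq : ∀ b ∈ S, G.Adj v b → b = a) : G.NotBipartiteOn S := by
  intro c
  obtain ⟨i, hi, j, hj, hij, hc⟩ := h (fun w => if w = v then !(c a) else c w)
  rcases Finset.mem_insert.1 hi with rfl | hiS <;> rcases Finset.mem_insert.1 hj with rfl | hjS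
  · exact (G.irrefl hij).elim
  · have hja := huniq j hjS hij
    have : j ≠ i := fun h => hv (h ▸ hjS)
    subst hja
    simp [this] at hc
  · have hia := huniq i hiS hij.symm
    have : i ≠ j := fun h => hv (h ▸ hiS)
    subst hia
    simp [this] at hc
  · have h1 : i ≠ v := fun h => hv (h ▸ hiS)
    have h2 : j ≠ v := fun h => hv (h ▸ hjS)
    simp only [h1, h2, if_false] at hc
    exact ⟨i, hiS, j, hjS, hij, hc⟩

variable [Fintype V] [DecidableRel G.Adj] {t : ℝ} {R : Finset V}

/-- Grow `S` from a grounded vertex: each new vertex outside `R` contributes a factor of at least `1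
+ t`, each new vertex in `R` a factor of at least `1`. -/
theorem ConnectedOn.pow_le_pminor (ht : 0 ≤ t) (hS : G.ConnectedOn S) (hR : (S ∩ R).Nonempty) :
    (1 + t) ^ (S \ R).card ≤ G.pminor t S R := by
  obtain ⟨u, hu⟩ := hR
  obtain ⟨huS, huR⟩ := Finset.mem_inter.1 hu
  have hg := hS.grows huS
  clear hu huS hS
  induction hg with
  | singleton =>
    have h0 : ({u} \ R).card = 0 := by simp [huR]
    rw [h0, pow_zero]
    have h := pminor_le_insert (G := G) (R := R) ht (Finset.notMem_empty u)
    simpa [pminor, groundedMatrix] using h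
  | @insert S v a hS hv ha hva ih =>
    by_cases hvR : v ∈ R
    · rw [Finset.insert_sdiff_of_mem _ hvR]
      exact ih.trans (pminor_le_insert ht hv)
    · rw [Finset.insert_sdiff_of_notMem _ hvR, Finset.card_insert_of_notMem (by simp [hv]), pow_succ']
      exact (mul_le_mul_of_nonneg_left ih (by positivity)).trans
        (pminor_insert_ge ht hv hvR ha hva)

/-- The bound for the deletion of a single vertex is attained only by dominating vertices. -/
theorem ConnectedOn.pow_lt_pminor (ht : 0 < t) (hS : G.ConnectedOn S) (huS : u ∈ S)
    (hu : ∃ w ∈ S, w ≠ u ∧ ¬ G.Adj u w) : (1 + t) ^ S.card < (1 + t) * G.pminor t S {u} := by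
  have hg := hS.grows huS
  clear huS hS
  induction hg with
  | singleton => simp at hu
  | @insert S v a hS hv ha hva ih =>
    have huS := hS.mem
    have hvu : v ∉ ({u} : Finset V) := by
      rw [Finset.mem_singleton]
      exact fun h => hv (h ▸ huS)
    have hpos := pminor_pos (G := G) ht.le
    have h0 : (1 + t) ^ S.card ≤ (1 + t) * G.pminor t S {u} := by
      have h := hS.connectedOn.pow_le_pminor (R := {u}) ht.le ⟨u, by simpa⟩
      rw [Finset.card_sdiff_of_subset (by simpa), Finset.card_singleton] at h
      have h2 : S.card = S.card - 1 + 1 := by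
        have := Finset.card_pos.2 ⟨u, huS⟩
        omega
      rw [h2, pow_succ']
      exact mul_le_mul_of_nonneg_left h (by positivity)
    rw [Finset.card_insert_of_notMem hv, pow_succ']
    -- A neighbor `b ≠ u` adds a positive term, hence strictness. Otherwise `v` hangs on `u` alone,
    -- and the non-neighbor of `u` already lies in `S`.
    by_cases hb : ∃ b ∈ S, b ≠ u ∧ G.Adj v b
    · obtain ⟨b, hbS, hbu, hvb⟩ := hb
      have h1 := pminor_insert_ge_of_notMem ht.le hv hvu hbS (by simpa using hbu) hvb
      have h2 := mul_pos ht (hpos S (insert b {u}))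
      have h3 : (1 + t) * (1 + t) ^ S.card ≤ (1 + t) * ((1 + t) * G.pminor t S {u}) :=
        mul_le_mul_of_nonneg_left h0 (by positivity)
      nlinarith [mul_pos ht h2]
    · push Not at hb
      have hau : a = u := by
        by_contra h
        exact hb a ha h hva
      subst hau
      have h1 := pminor_insert_ge ht.le hv hvu ha hva
      obtain ⟨w, hw, hwu, haw⟩ := hu
      have hwS : w ∈ S := by
        rcases Finset.mem_insert.1 hw with rfl | h
        · exact (haw hva.symm).elim
        · exact h
      have h2 := mul_lt_mul_of_pos_left (ih ⟨w, hwS, hwu, haw⟩) (show 0 < 1 + t by positivity)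
      refine h2.trans_le (mul_le_mul_of_nonneg_left h1 (by positivity))

/-- On at least two vertices the bound is the value for the star, whose signless Laplacian
eigenvalues are the order, `0`, and otherwise `1`. The factor `(1 + t) ^ 2` avoids truncated
subtraction in the exponent. -/
theorem ConnectedOn.le_pminor_empty (ht : 0 ≤ t) (hS : G.ConnectedOn S) :
    (1 + t) ^ S.card * (1 + S.card * t) ≤ (1 + t) ^ 2 * G.pminor t S ∅ := by
  obtain ⟨u, hu⟩ := hS.1
  have hg := hS.grows hu
  clear hu hS
  induction hg with
  | singleton =>
    have h := pminor_le_insert (G := G) (R := ∅) ht (Finset.notMem_empty u)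
    have h1 : 1 ≤ G.pminor t {u} ∅ := by simpa [pminor, groundedMatrix] using h
    simp only [Finset.card_singleton]
    push_cast
    nlinarith [sq_nonneg (1 + t)]
  | @insert S v a hS hv ha hva ih =>
    have h := hS.connectedOn.pow_le_pminor (R := {a}) ht ⟨a, by simpa⟩
    rw [Finset.card_sdiff_of_subset (by simpa), Finset.card_singleton] at h
    have h2 : S.card = S.card - 1 + 1 := by
      have := Finset.card_pos.2 ⟨a, ha⟩
      omega
    have h3 := pminor_insert_ge_of_notMem (R := ∅) ht hv (Finset.notMem_empty v) ha
      (Finset.notMem_empty a) hva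
    rw [insert_empty_eq] at h3
    rw [Finset.card_insert_of_notMem hv]
    have h4 : (1 + t) ^ S.card ≤ (1 + t) * G.pminor t S {a} := by
      rw [h2, pow_succ']
      exact mul_le_mul_of_nonneg_left h (by positivity)
    push_cast
    have h5 := mul_le_mul_of_nonneg_left h3 (show 0 ≤ (1 + t) ^ 2 by positivity)
    have h6 := mul_le_mul_of_nonneg_left ih (show 0 ≤ 1 + t by positivity)
    have h7 := mul_le_mul_of_nonneg_left h4 (show 0 ≤ t * (1 + t) by positivity)
    rw [pow_succ']
    nlinarith

end SimpleGraph

/-! ### The minor at one vertex of a non-bipartite set. -/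

namespace SimpleGraph

variable {V : Type*} [DecidableEq V] [Fintype V] {G : SimpleGraph V} [DecidableRel G.Adj]
  {S : Finset V} {u v a b : V} {t : ℝ}

theorem ConnectedOn.pow_card_le (ht : 0 ≤ t) (hS : G.ConnectedOn S) (hu : u ∈ S) :
    (1 + t) ^ S.card ≤ (1 + t) * G.pminor t S {u} := by
  have h := hS.pow_le_pminor (R := {u}) ht ⟨u, by simpa⟩
  rw [Finset.card_sdiff_of_subset (by simpa), Finset.card_singleton] at h
  have h2 : S.card = S.card - 1 + 1 := by
    have := Finset.card_pos.2 ⟨u, hu⟩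
    omega
  rw [h2, pow_succ']
  exact mul_le_mul_of_nonneg_left h (by positivity)

theorem ConnectedOn.pow_card_le_pair (ht : 0 ≤ t) (hS : G.ConnectedOn S) (ha : a ∈ S)
    (hb : b ∈ S) (hab : a ≠ b) : (1 + t) ^ S.card ≤ (1 + t) ^ 2 * G.pminor t S {a, b} := by
  have h := hS.pow_le_pminor (R := {a, b}) ht ⟨a, by simpa⟩
  have hsub : {a, b} ⊆ S := by grind
  have hc := Finset.card_le_card hsub
  rw [Finset.card_sdiff_of_subset hsub] at h
  rw [Finset.card_pair hab] at h hc
  have h2 : S.card = 2 + (S.card - 2) := by omega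
  rw [h2, pow_add]
  exact mul_le_mul_of_nonneg_left h (by positivity)

/-- As `t + t² = t P`, the three bounds give at least `P p (1 + 4 t)` on the right, so strictness
comes for free. -/
theorem pow_mul_lt_of_odd_cycle {F Fa Fb p P : ℝ} (ht : 0 < t) (hP : P = 1 + t) (hF : p ≤ P * F)
    (hFa : p ≤ P ^ 2 * Fa) (hFb : p ≤ P ^ 2 * Fb) (hp : 0 < p) :
    P * p * (1 + 3 * t) < P ^ 2 * ((1 + 2 * t) * F + (t + t ^ 2) * (Fa + Fb)) := by
  have hP0 : 0 < P := by linarith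
  have e1 := mul_le_mul_of_nonneg_left hF (show 0 ≤ P * (1 + 2 * t) by positivity)
  have e2 := mul_le_mul_of_nonneg_left hFa (show 0 ≤ t + t ^ 2 by positivity)
  have e3 := mul_le_mul_of_nonneg_left hFb (show 0 ≤ t + t ^ 2 by positivity)
  have e4 : 0 < p * t := by positivity
  subst hP
  nlinarith [mul_pos e4 ht]

/-- The minor at a single vertex of a connected set which is not bipartite. -/
theorem ConnectedOn.le_pminor_singleton (ht : 0 < t) (hS : G.ConnectedOn S)
    (hnb : G.NotBipartiteOn S) (hu : u ∈ S) :
    (1 + t) ^ S.card * (1 + 3 * t) ≤ (1 + t) ^ 2 * G.pminor t S {u} ∧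
      ((∃ w ∈ S, w ≠ u ∧ ¬ G.Adj u w) →
        (1 + t) ^ S.card * (1 + 3 * t) < (1 + t) ^ 2 * G.pminor t S {u}) := by
  have hg := hS.grows hu
  clear hu hS
  induction hg with
  | singleton =>
    obtain ⟨i, hi, j, hj, hij, -⟩ := hnb fun _ => true
    rw [Finset.mem_singleton] at hi hj
    exact (G.irrefl (hi ▸ hj ▸ hij)).elim
  | @insert S v a hS hv ha hva ih =>
    have hconn := hS.connectedOn
    have huS := hS.mem
    have hvu : v ∉ ({u} : Finset V) := by
      rw [Finset.mem_singleton]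
      exact fun h => hv (h ▸ huS)
    have hP : 0 < 1 + t := by positivity
    have hpow : 0 < (1 + t) ^ S.card := by positivity
    have h0 := hconn.pow_card_le ht.le huS
    rw [Finset.card_insert_of_notMem hv, pow_succ']
    have hdom : (∃ w ∈ insert v S, w ≠ u ∧ ¬ G.Adj u w) → G.Adj v u →
        ∃ w ∈ S, w ≠ u ∧ ¬ G.Adj u w := by
      rintro ⟨w, hw, hwu, huw⟩ hvu
      rcases Finset.mem_insert.1 hw with rfl | h
      · exact (huw hvu.symm).elim
      · exact ⟨w, h, hwu, huw⟩
    -- Either the set was non-bipartite before `v` was added, or `v` is the vertex that closes an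
    -- odd cycle.
    by_cases hnbS : G.NotBipartiteOn S
    · obtain ⟨ih1, ih2⟩ := ih hnbS
      by_cases hb : ∃ b ∈ S, b ≠ u ∧ G.Adj v b
      · obtain ⟨b, hbS, hbu, hvb⟩ := hb
        have h1 := pminor_insert_ge_of_notMem ht.le hv hvu hbS (by simpa using hbu) hvb
        have h2 := mul_pos ht (pminor_pos (G := G) ht.le S (insert b {u}))
        have h3 := mul_le_mul_of_nonneg_left ih1 hP.le
        have h4 := mul_le_mul_of_nonneg_left h1 (sq_nonneg (1 + t))
        have h5 : 0 < (1 + t) ^ 2 * (t * G.pminor t S (insert b {u})) := by positivity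
        have : (1 + t) * (1 + t) ^ S.card * (1 + 3 * t) <
            (1 + t) ^ 2 * G.pminor t (insert v S) {u} := by linarith
        exact ⟨this.le, fun _ => this⟩
      · push Not at hb
        have hau : a = u := by
          by_contra h
          exact hb a ha h hva
        subst hau
        have h1 := mul_le_mul_of_nonneg_left (pminor_insert_ge ht.le hv hvu ha hva)
          (sq_nonneg (1 + t))
        refine ⟨?_, fun hw => ?_⟩
        · have h2 := mul_le_mul_of_nonneg_left ih1 hP.le
          linarith
        · have h2 := mul_lt_mul_of_pos_left (ih2 (hdom hw hva)) hP
          linarith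
    · rw [NotBipartiteOn] at hnbS
      push Not at hnbS
      obtain ⟨c, hc⟩ := hnbS
      -- If all neighbors of `v` had the color of `a`, giving `v` the opposite color would extend
      -- `c`.
      obtain ⟨x, hx, hvx, y, hy, hvy, hxy⟩ :
          ∃ x ∈ S, G.Adj v x ∧ ∃ y ∈ S, G.Adj v y ∧ c x ≠ c y := by
        by_contra! hcon
        obtain ⟨i, hi, j, hj, hij, hcij⟩ := hnb fun w => if w = v then !(c a) else c w
        have key : ∀ j ∈ S, G.Adj v j → c j = c a := fun j hj hvj => hcon j hj hvj a ha hva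
        have hne : ∀ j ∈ S, j ≠ v := fun j hj h => hv (h ▸ hj)
        rcases Finset.mem_insert.1 hi with rfl | hiS <;> rcases Finset.mem_insert.1 hj with rfl | hjS
        · exact (G.irrefl hij).elim
        · simp [hne j hjS, key j hjS hij] at hcij
        · simp [hne i hiS, key i hiS hij.symm] at hcij
        · simp only [hne i hiS, hne j hjS, if_false] at hcij
          exact hc i hiS j hjS hij hcij
      -- One of the two differently colored neighbors is `u` itself, so its edge to `v` acts as a
      -- loop. This is the sharp case: `(1 + 2 t) + t = 1 + 3 t`.
      have key : ∀ y ∈ S, G.Adj v y → G.Adj v u → y ≠ u →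
          (1 + t) * (1 + t) ^ S.card * (1 + 3 * t) ≤
            (1 + t) ^ 2 * G.pminor t (insert v S) {u} ∧
          ((∃ w ∈ insert v S, w ≠ u ∧ ¬ G.Adj u w) →
            (1 + t) * (1 + t) ^ S.card * (1 + 3 * t) <
              (1 + t) ^ 2 * G.pminor t (insert v S) {u}) := by
        intro y hy hvy hvu' hyu
        have h1 := mul_le_mul_of_nonneg_left (pminor_insert_ge_of_mem_of_notMem ht.le hv hvu huS
          (by simp) hvu' hy (by simpa using hyu) hvy) (sq_nonneg (1 + t))
        have h2 := hconn.pow_card_le_pair ht.le hy huS hyu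
        have h3 := mul_le_mul_of_nonneg_left h2 (show 0 ≤ t + t ^ 2 by positivity)
        refine ⟨?_, fun hw => ?_⟩
        · have h4 := mul_le_mul_of_nonneg_left h0 (show 0 ≤ (1 + t) * (1 + 2 * t) by positivity)
          nlinarith
        · have h4 := mul_lt_mul_of_pos_left (hconn.pow_lt_pminor ht huS (hdom hw hvu'))
            (show 0 < (1 + t) * (1 + 2 * t) by positivity)
          nlinarith
      by_cases hxu : x = u
      · subst hxu
        exact key y hy hvy hvx (fun h => hxy (h ▸ rfl))
      by_cases hyu : y = u
      · subst hyu
        exact key x hx hvx hvy (fun h => hxy (h ▸ rfl))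
      · have h1 := mul_le_mul_of_nonneg_left (pminor_insert_ge_of_ne_color (R := {u}) ht.le hv hvu
          c hc hxy hx (by simpa using hxu) hvx hy (by simpa using hyu) hvy) (sq_nonneg (1 + t))
        have h2 := pow_mul_lt_of_odd_cycle ht rfl h0 (hconn.pow_card_le_pair ht.le hx huS hxu)
          (hconn.pow_card_le_pair ht.le hy huS hyu) hpow
        exact ⟨(h2.trans_le h1).le, fun _ => h2.trans_le h1⟩

end SimpleGraph

/-! ### Odd cycles: replacing three consecutive edges by one. -/

namespace SimpleGraph

/-- The value of `det (1 + t Q)` for the triangle with `n - 3` pendent edges at one vertex is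
`(1 + t) ^ (n - 3)` times this cubic. -/
def pendantCubic (n : ℕ) (t : ℝ) : ℝ := 1 + (n + 3) * t + 3 * n * t ^ 2 + 4 * t ^ 3

/-- Inserting the bounds into the path identity leaves a surplus of `p (t² + t³ + 2 (k - 3) t⁴)`,
positive because `k ≥ 3`. So every shortening is strict. -/
theorem pow_mul_pendantCubic_lt {k : ℕ} {t p P f f' D Dx Dy Dxy : ℝ} (ht : 0 < t)
    (hP : P = 1 + t) (hk : 3 ≤ k) (hp : 0 < p)
    (hf : f = t ^ 2 * f' + (1 + 4 * t + 2 * t ^ 2) * D + (t + 3 * t ^ 2) * (Dx + Dy) +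
      t ^ 2 * (1 + 2 * t) * Dxy) (hf' : p * pendantCubic k t ≤ P ^ 3 * f')
    (hD : p * (1 + k * t) ≤ P ^ 2 * D) (hDx : p ≤ P * Dx) (hDy : p ≤ P * Dy)
    (hDxy : p ≤ P ^ 2 * Dxy) : P ^ 2 * p * pendantCubic (k + 2) t < P ^ 3 * f := by
  have hP0 : 0 < P := by linarith
  have hk' : (3 : ℝ) ≤ k := by exact_mod_cast hk
  have e1 := mul_le_mul_of_nonneg_left hf' (sq_nonneg t)
  have e2 := mul_le_mul_of_nonneg_left hD (show 0 ≤ P * (1 + 4 * t + 2 * t ^ 2) by positivity)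
  have e3 := mul_le_mul_of_nonneg_left hDx (show 0 ≤ P ^ 2 * (t + 3 * t ^ 2) by positivity)
  have e4 := mul_le_mul_of_nonneg_left hDy (show 0 ≤ P ^ 2 * (t + 3 * t ^ 2) by positivity)
  have e5 := mul_le_mul_of_nonneg_left hDxy (show 0 ≤ P * (t ^ 2 * (1 + 2 * t)) by positivity)
  have e6 : P ^ 3 * f = t ^ 2 * (P ^ 3 * f') + P * (1 + 4 * t + 2 * t ^ 2) * (P ^ 2 * D) +
      P ^ 2 * (t + 3 * t ^ 2) * (P * Dx) + P ^ 2 * (t + 3 * t ^ 2) * (P * Dy) +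
      P * (t ^ 2 * (1 + 2 * t)) * (P ^ 2 * Dxy) := by
    rw [hf]
    ring
  have e7 : t ^ 2 * (p * pendantCubic k t) + P * (1 + 4 * t + 2 * t ^ 2) * (p * (1 + k * t)) +
      P ^ 2 * (t + 3 * t ^ 2) * p + P ^ 2 * (t + 3 * t ^ 2) * p +
      P * (t ^ 2 * (1 + 2 * t)) * p = P ^ 2 * p * pendantCubic (k + 2) t +
      p * (t ^ 2 + t ^ 3 + 2 * (k - 3) * t ^ 4) := by
    rw [hP]
    simp only [pendantCubic]
    push_cast
    ring
  have e8 : 0 < p * (t ^ 2 + t ^ 3 + 2 * (k - 3) * t ^ 4) := by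
    have : 0 ≤ (k : ℝ) - 3 := by linarith
    positivity
  linarith

variable {V : Type*}

theorem ConnectedOn.mono {G H : SimpleGraph V} (h : G ≤ H) {S : Finset V}
    (hS : G.ConnectedOn S) : H.ConnectedOn S :=
  ⟨hS.1, fun T hT hne hT' =>
    let ⟨a, ha, b, hb, hbT, hab⟩ := hS.2 T hT hne hT'
    ⟨a, ha, b, hb, hbT, h hab⟩⟩

theorem sup_edge_adj_iff {G : SimpleGraph V} {a b i j : V} (hab : a ≠ b) :
    (G ⊔ edge a b).Adj i j ↔ G.Adj i j ∨ (i = a ∧ j = b) ∨ (i = b ∧ j = a) := by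
  rw [sup_adj, edge_adj]
  grind

variable [DecidableEq V]

theorem groundedMatrix_sup_edge {G : SimpleGraph V} [DecidableRel G.Adj] {a b : V}
    [DecidableRel (G ⊔ edge a b).Adj] {S : Finset V} (R : Finset V) (t : ℝ) (ha : a ∈ S)
    (hb : b ∈ S) (hab : a ≠ b) (hG : ¬ G.Adj a b) :
    (G ⊔ edge a b).groundedMatrix t S R = G.groundedMatrix t S R + t • outerSq (edgeVec R a b) := by
  have h : (S ×ˢ S).filter (fun p => (G ⊔ edge a b).Adj p.1 p.2) =
      insert (a, b) (insert (b, a) ((S ×ˢ S).filter (fun p => G.Adj p.1 p.2))) := by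
    ext ⟨i, j⟩
    simp only [Finset.mem_filter, Finset.mem_product, Finset.mem_insert, Prod.mk.injEq,
      sup_edge_adj_iff hab]
    grind
  rw [groundedMatrix, h, Finset.sum_insert, Finset.sum_insert, edgeVec_comm R b a, groundedMatrix]
  · have h2 : t • outerSq (edgeVec R a b) =
        (t / 2) • outerSq (edgeVec R a b) + (t / 2) • outerSq (edgeVec R a b) := by
      rw [← add_smul, add_halves]
    rw [h2]
    abel
  · simp [G.adj_comm b a, hG]
  · simp [hG, hab]

/-- A coloring of the shortened graph that separates `x'` and `y'` extends over the path by giving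
`x` and `y` the opposites of the colors of `x'` and `y'`. -/
theorem NotBipartiteOn.sup_edge {G : SimpleGraph V} {S : Finset V} {x y x' y' : V}
    (hnb : G.NotBipartiteOn (insert x (insert y S))) (hx : x ∉ S) (hy : y ∉ S) (hyx : y ≠ x)
    (hx' : x' ∈ S) (hy' : y' ∈ S) (hx'y' : x' ≠ y') (hNx : ∀ j ∈ S, G.Adj x j ↔ j = x')
    (hNy : ∀ j ∈ S, G.Adj y j ↔ j = y') : (G ⊔ edge x' y').NotBipartiteOn S := by
  intro c
  by_cases hc : c x' = c y'
  · exact ⟨x', hx', y', hy', (sup_edge_adj_iff hx'y').2 (by simp), hc⟩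
  · obtain ⟨i, hi, j, hj, hij, hcij⟩ :=
      hnb fun w => if w = x then !(c x') else if w = y then !(c y') else c w
    have hxS : ∀ w ∈ S, w ≠ x ∧ w ≠ y := fun w hw => ⟨fun h => hx (h ▸ hw), fun h => hy (h ▸ hw)⟩
    have hi' : i = x ∨ i = y ∨ i ∈ S := by grind
    have hj' : j = x ∨ j = y ∨ j ∈ S := by grind
    rcases hi' with rfl | rfl | hi' <;> rcases hj' with rfl | rfl | hj'
    · exact (G.irrefl hij).elim
    · simp [hyx] at hcij
      exact (hc hcij).elim
    · have := (hNx j hj').1 hij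
      simp [hxS x' hx', this] at hcij
    · simp [hyx] at hcij
      exact (hc hcij.symm).elim
    · exact (G.irrefl hij).elim
    · have := (hNy j hj').1 hij
      simp [hxS y' hy', this, hyx] at hcij
    · have := (hNx i hi').1 hij.symm
      simp [hxS x' hx', this] at hcij
    · have := (hNy i hi').1 hij.symm
      simp [hxS y' hy', this, hyx] at hcij
    · simp [hxS i hi', hxS j hj'] at hcij
      exact ⟨i, hi', j, hj', (sup_edge_adj_iff hx'y').2 (.inl hij), hcij⟩

/-- Degrees survive the shortening: `x'` trades its neighbor `x` for `y'`, and `y'` trades `y` for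
`x'`. -/
theorem card_filter_sup_edge_adj {G : SimpleGraph V} [DecidableRel G.Adj] {S : Finset V}
    {x y x' y' v : V} [DecidableRel (G ⊔ edge x' y').Adj] (hx : x ∉ S) (hy : y ∉ S)
    (hx' : x' ∈ S) (hy' : y' ∈ S) (hx'y' : x' ≠ y') (hadj : ¬ G.Adj x' y')
    (hNx : ∀ j ∈ S, G.Adj x j ↔ j = x') (hNy : ∀ j ∈ S, G.Adj y j ↔ j = y') (hv : v ∈ S) :
    (S.filter ((G ⊔ edge x' y').Adj v)).card =
      ((insert x (insert y S)).filter (G.Adj v)).card := by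
  have hvx : G.Adj v x ↔ v = x' := by rw [G.adj_comm, hNx v hv]
  have hvy : G.Adj v y ↔ v = y' := by rw [G.adj_comm, hNy v hv]
  by_cases h1 : v = x'
  · subst h1
    have e1 : S.filter ((G ⊔ edge v y').Adj v) = insert y' (S.filter (G.Adj v)) := by
      ext c
      simp only [Finset.mem_filter, Finset.mem_insert, sup_edge_adj_iff hx'y']
      grind
    have e2 : (insert x (insert y S)).filter (G.Adj v) = insert x (S.filter (G.Adj v)) := by
      ext c
      simp only [Finset.mem_filter, Finset.mem_insert]
      grind
    rw [e1, e2, Finset.card_insert_of_notMem (by simp [hadj]),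
      Finset.card_insert_of_notMem (by simp [hx])]
  by_cases h2 : v = y'
  · subst h2
    have e1 : S.filter ((G ⊔ edge x' v).Adj v) = insert x' (S.filter (G.Adj v)) := by
      ext c
      simp only [Finset.mem_filter, Finset.mem_insert, sup_edge_adj_iff hx'y']
      grind
    have e2 : (insert x (insert y S)).filter (G.Adj v) = insert y (S.filter (G.Adj v)) := by
      ext c
      simp only [Finset.mem_filter, Finset.mem_insert]
      grind
    rw [e1, e2, Finset.card_insert_of_notMem (by simp [G.adj_comm v, hadj]),
      Finset.card_insert_of_notMem (by simp [hy])]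
  · congr 1
    ext c
    simp only [Finset.mem_filter, Finset.mem_insert, sup_edge_adj_iff hx'y']
    grind

theorem groundedMatrix_insert_insert {G : SimpleGraph V} [DecidableRel G.Adj] {S : Finset V}
    {x y x' y' : V} (t : ℝ) (hx : x ∉ insert y S) (hy : y ∉ S) (hx'y : x' ≠ y) (hxy : G.Adj x y)
    (hNx : S.filter (G.Adj x) = {x'}) (hNy : S.filter (G.Adj y) = {y'}) :
    G.groundedMatrix t (insert x (insert y S)) ∅ = G.groundedMatrix t S ∅ +
      t • outerSq (Pi.single x 1 + Pi.single x' 1) + t • outerSq (Pi.single x 1 + Pi.single y 1) +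
      t • outerSq (Pi.single y 1 + Pi.single y' 1) := by
  rw [groundedMatrix_insert hx, groundedMatrix_insert hy, Finset.filter_insert, if_pos hxy, hNx,
    hNy, Finset.sum_pair hx'y.symm, Finset.sum_singleton]
  simp only [edgeVec_of_notMem (Finset.notMem_empty _) (Finset.notMem_empty _)]
  rw [add_comm (Pi.single y' 1), add_comm (Pi.single y 1) (Pi.single x 1),
    add_comm (Pi.single x' 1)]
  abel

variable [Fintype V]

theorem pminor_insert_insert {G : SimpleGraph V} [DecidableRel G.Adj] {S : Finset V}
    {x y x' y' : V} [DecidableRel (G ⊔ edge x' y').Adj] {t : ℝ} (ht : 0 ≤ t)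
    (hx : x ∉ insert y S) (hy : y ∉ S) (hx'y : x' ≠ y) (hxy : G.Adj x y)
    (hNx : S.filter (G.Adj x) = {x'}) (hNy : S.filter (G.Adj y) = {y'}) (hx'y' : x' ≠ y')
    (hadj : ¬ G.Adj x' y') :
    G.pminor t (insert x (insert y S)) ∅ = t ^ 2 * (G ⊔ edge x' y').pminor t S ∅ +
      (1 + 4 * t + 2 * t ^ 2) * G.pminor t S ∅ +
      (t + 3 * t ^ 2) * (G.pminor t S {x'} + G.pminor t S {y'}) +
      t ^ 2 * (1 + 2 * t) * G.pminor t S {x', y'} := by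
  have hx'S : x' ∈ S := (Finset.mem_filter.1 (hNx ▸ Finset.mem_singleton_self x')).1
  have hy'S : y' ∈ S := (Finset.mem_filter.1 (hNy ▸ Finset.mem_singleton_self y')).1
  have hxS : x ∉ S := fun h => hx (Finset.mem_insert_of_mem h)
  have hh := groundedMatrix_sup_edge (G := G) ∅ t hx'S hy'S hx'y' hadj
  rw [edgeVec_of_notMem (Finset.notMem_empty _) (Finset.notMem_empty _)] at hh
  simp only [pminor]
  rw [hh, groundedMatrix_insert_insert t hx hy hx'y hxy hNx hNy,
    det_add_path (posDef_groundedMatrix ht S ∅) (groundedMatrix_apply_of_notMem hxS)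
    (groundedMatrix_apply_of_notMem hy) hxy.ne (fun h => hxS (h ▸ hx'S)) hx'y
    (fun h => hxS (h ▸ hy'S)) (fun h => hy (h ▸ hy'S)) hx'y']
  simp only [ground_groundedMatrix, Finset.union_empty]

set_option maxHeartbeats 800000 in
/-- Reduction of a 2-regular graph by replacing a path of three edges by a single edge. -/
theorem ConnectedOn.le_pminor_of_two_regular {t : ℝ} (ht : 0 < t) (n : ℕ) :
    ∀ (G : SimpleGraph V) [DecidableRel G.Adj] (S : Finset V), S.card = n → G.ConnectedOn S →
      G.NotBipartiteOn S → (∀ v ∈ S, (S.filter (G.Adj v)).card = 2) →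
      (1 + t) ^ n * pendantCubic n t ≤ (1 + t) ^ 3 * G.pminor t S ∅ ∧
        ((¬ ∃ u ∈ S, ∀ w ∈ S, w ≠ u → G.Adj u w) →
          (1 + t) ^ n * pendantCubic n t < (1 + t) ^ 3 * G.pminor t S ∅) := by
  induction n using Nat.strong_induction_on with
  | _ n ih =>
  intro G _ S hn hS hnb hreg
  obtain ⟨u, hu⟩ := hS.1
  -- The last vertex `x` of a growth sequence can be removed without disconnecting; then `y` is a
  -- leaf and can be removed as well.
  cases hS.grows hu with
  | singleton =>
    obtain ⟨i, hi, j, hj, hij, -⟩ := hnb fun _ => true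
    rw [Finset.mem_singleton] at hi hj
    exact (G.irrefl (hi ▸ hj ▸ hij)).elim
  | @insert S₁ x y hg hx hy hxy =>
  have hS₁ := hg.connectedOn
  clear hu hg
  have nbrs : ∀ v ∈ insert x S₁, ∀ a ∈ insert x S₁, G.Adj v a → ∃ b ∈ insert x S₁, b ≠ a ∧
      ∀ c ∈ insert x S₁, G.Adj v c ↔ c = a ∨ c = b := by
    intro v hv a ha hva
    obtain ⟨p, q, hpq, hpq'⟩ := Finset.card_eq_two.1 (hreg v hv)
    have hm : ∀ c, (c ∈ insert x S₁ ∧ G.Adj v c) ↔ (c = p ∨ c = q) := by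
      intro c
      rw [← Finset.mem_filter, hpq']
      simp
    rcases (hm a).1 ⟨ha, hva⟩ with rfl | rfl
    · exact ⟨q, ((hm q).2 (.inr rfl)).1, hpq.symm, fun c hc => by rw [← hm c]; simp [hc]⟩
    · exact ⟨p, ((hm p).2 (.inl rfl)).1, hpq, fun c hc => by
        rw [or_comm, ← hm c]; simp [hc]⟩
  have hyx : y ≠ x := fun h => hx (h ▸ hy)
  obtain ⟨x', hx', hx'y, hNx⟩ := nbrs x (by simp) y (by simp [hy]) hxy
  obtain ⟨y', hy', hy'x, hNy⟩ := nbrs y (by simp [hy]) x (by simp) hxy.symm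
  have hxx' : G.Adj x x' := (hNx x' hx').2 (.inr rfl)
  have hyy' : G.Adj y y' := (hNy y' hy').2 (.inr rfl)
  obtain ⟨S₂, hyS₂, rfl⟩ : ∃ S₂, y ∉ S₂ ∧ S₁ = insert y S₂ :=
    ⟨S₁.erase y, by simp, (Finset.insert_erase hy).symm⟩
  have hxS₂ : x ∉ S₂ := fun h => hx (Finset.mem_insert_of_mem h)
  have hx'₂ : x' ∈ S₂ := by
    have := hxx'.ne'
    grind
  have hy'₂ : y' ∈ S₂ := by
    have := hyy'.ne'
    grind
  have hNx₂ : S₂.filter (G.Adj x) = {x'} := by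
    ext c
    have := hNx c
    grind
  have hNy₂ : S₂.filter (G.Adj y) = {y'} := by
    ext c
    have := hNy c
    grind
  have hS₂ : G.ConnectedOn S₂ := hS₁.of_insert hyS₂ hy'₂ (fun b hb hyb => by
    have := (hNy b (by simp [hb])).1 hyb
    grind)
  have hcard : n = S₂.card + 2 := by
    rw [← hn, Finset.card_insert_of_notMem hx, Finset.card_insert_of_notMem hyS₂]
  have hM : G.groundedMatrix t (insert x (insert y S₂)) ∅ = G.groundedMatrix t S₂ ∅ +
      t • outerSq (Pi.single x 1 + Pi.single x' 1) + t • outerSq (Pi.single x 1 + Pi.single y 1) +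
      t • outerSq (Pi.single y 1 + Pi.single y' 1) := 
    groundedMatrix_insert_insert t hx hyS₂ hx'y hxy hNx₂ hNy₂
  have hxx'ne : x' ≠ x := hxx'.ne'
  have hyy'ne : y' ≠ y := hyy'.ne'
  -- Here `x, y, x'` form a triangle whose vertices have no further neighbors, so by connectedness
  -- it is the whole set.
  by_cases hx'y' : x' = y'
  · subst hx'y'
    have hS₂' : S₂ = {x'} := by
      by_contra hne
      obtain ⟨p, hp, b, hb, hbx', hpb⟩ := hS₂.2 {x'} (by simpa) (by simp) (Ne.symm hne)
      rw [Finset.mem_singleton] at hp hbx'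
      subst hp
      obtain ⟨c, hc, hcx, hN⟩ := nbrs p hx' x (by simp) hxx'.symm
      have h1 := (hN y (by simp)).1 hyy'.symm
      have h2 := (hN b (by simp [hb])).1 hpb
      grind
    have hval : G.pminor t (insert x (insert y S₂)) ∅ = (1 + t) ^ 2 * (1 + 4 * t) := by
      rw [← det_one_add_triangle hyx.symm hxx'ne.symm hyy'ne.symm (V := V), pminor, hM]
      have : G.groundedMatrix t S₂ ∅ = 1 := by
        rw [hS₂', ← insert_empty_eq, groundedMatrix_insert (Finset.notMem_empty _)]
        simp [groundedMatrix]
      rw [this]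
    have hn3 : n = 3 := by
      rw [hcard, hS₂', Finset.card_singleton]
    refine ⟨le_of_eq ?_, fun h => (h ⟨x, by simp, fun w hw hwx => ?_⟩).elim⟩
    · rw [hval, hn3, pendantCubic]
      push_cast
      ring
    · rw [hNx w hw]
      grind
  -- Otherwise the set is the 4-cycle `x y y' x'`, properly colored by `{x, y'}` against `{y, x'}`.
  have hadj : ¬ G.Adj x' y' := by
    intro hadj
    have hS₂' : S₂ = {x', y'} := by
      by_contra hne
      obtain ⟨p, hp, b, hb, hb', hpb⟩ := hS₂.2 {x', y'} (by grind) (by simp) (Ne.symm hne)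
      rcases (by simpa using hp : p = x' ∨ p = y') with rfl | rfl
      · obtain ⟨c, hc, hcx, hN⟩ := nbrs p hx' x (by simp) hxx'.symm
        have h1 := (hN y' hy').1 hadj
        have h2 := (hN b (by simp [hb])).1 hpb
        grind
      · obtain ⟨c, hc, hcx, hN⟩ := nbrs p hy' y (by simp) hyy'.symm
        have h1 := (hN x' hx').1 hadj.symm
        have h2 := (hN b (by simp [hb])).1 hpb
        grind
    have hNx' : ∀ c ∈ insert x (insert y S₂), G.Adj x' c → c = x ∨ c = y' := by
      obtain ⟨b, hb, hbx, hN⟩ := nbrs x' hx' x (by simp) hxx'.symm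
      have := (hN y' hy').1 hadj
      grind
    have hNy' : ∀ c ∈ insert x (insert y S₂), G.Adj y' c → c = y ∨ c = x' := by
      obtain ⟨b, hb, hbx, hN⟩ := nbrs y' hy' y (by simp) hyy'.symm
      have := (hN x' hx').1 hadj.symm
      grind
    obtain ⟨i, hi, j, hj, hij, hc⟩ := hnb fun w => decide (w = x ∨ w = y')
    have hi' : i = x ∨ i = y ∨ i = x' ∨ i = y' := by grind
    clear ih hM hNx₂ hNy₂ hS hS₁ hS₂ hreg nbrs hnb
    rcases hi' with rfl | rfl | rfl | rfl
    · rcases (hNx j hj).1 hij with rfl | rfl <;> simp_all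
    · rcases (hNy j hj).1 hij with rfl | rfl <;> simp_all
    · rcases hNx' j hj hij with rfl | rfl <;> simp_all
    · rcases hNy' j hj hij with rfl | rfl <;> simp_all
  classical
  let G' := G ⊔ edge x' y'
  have hG'nb : G'.NotBipartiteOn S₂ := hnb.sup_edge hxS₂ hyS₂ hyx hx'₂ hy'₂ hx'y'
    (fun j hj => by rw [← Finset.mem_singleton, ← hNx₂]; simp [hj])
    (fun j hj => by rw [← Finset.mem_singleton, ← hNy₂]; simp [hj])
  have hG'reg : ∀ v ∈ S₂, (S₂.filter (G'.Adj v)).card = 2 := fun v hv => by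
    rw [← hreg v (by simp [hv])]
    exact card_filter_sup_edge_adj hxS₂ hyS₂ hx'₂ hy'₂ hx'y' hadj
      (fun j hj => by rw [← Finset.mem_singleton, ← hNx₂]; simp [hj])
      (fun j hj => by rw [← Finset.mem_singleton, ← hNy₂]; simp [hj]) hv
  -- Connectedness gives `x'` a neighbor in `S₂`, and it is not `y'`.
  have hk : 3 ≤ S₂.card := by
    obtain ⟨p, hp, b, hb, hb', hpb⟩ := hS₂.2 {x'} (by simpa) (by simp) (by grind)
    rw [Finset.mem_singleton] at hp hb'
    subst hp
    have hby : b ≠ y' := by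
      rintro rfl
      exact hadj hpb
    rw [← Finset.card_eq_three.2 ⟨p, y', b, hx'y', Ne.symm hb', hby.symm, rfl⟩]
    exact Finset.card_le_card (by simp [Finset.insert_subset_iff, hx'₂, hy'₂, hb])
  have hIH := (ih S₂.card (by omega) G' S₂ rfl (hS₂.mono le_sup_left) hG'nb hG'reg).1
  have hf : G.pminor t (insert x (insert y S₂)) ∅ = t ^ 2 * G'.pminor t S₂ ∅ +
      (1 + 4 * t + 2 * t ^ 2) * G.pminor t S₂ ∅ +
      (t + 3 * t ^ 2) * (G.pminor t S₂ {x'} + G.pminor t S₂ {y'}) +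
      t ^ 2 * (1 + 2 * t) * G.pminor t S₂ {x', y'} := 
    pminor_insert_insert ht.le hx hyS₂ hx'y hxy hNx₂ hNy₂ hx'y' hadj
  have hlt := pow_mul_pendantCubic_lt ht rfl hk (show 0 < (1 + t) ^ S₂.card by positivity) hf hIH
    (hS₂.le_pminor_empty ht.le) (hS₂.pow_card_le ht.le hx'₂) (hS₂.pow_card_le ht.le hy'₂)
    (hS₂.pow_card_le_pair ht.le hx'₂ hy'₂ hx'y')
  rw [hcard, pow_add, mul_comm ((1 + t) ^ S₂.card)]
  exact ⟨hlt.le, fun _ => hlt⟩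

end SimpleGraph

/-! ### The determinant bound for unicyclic graphs of odd girth. -/

namespace SimpleGraph

variable {V : Type*}

theorem notBipartiteOn_univ_of_odd_girth [Fintype V] {G : SimpleGraph V} (hodd : Odd G.girth) :
    G.NotBipartiteOn Finset.univ := by
  intro c
  by_contra! h
  -- The girth of an acyclic graph is `0` by convention, which is not odd.
  have hac : ¬ G.IsAcyclic := fun hac => by simp [girth_eq_zero.2 hac] at hodd
  obtain ⟨a, w, -, hl⟩ := exists_girth_eq_length.2 hac
  have := (Coloring.odd_length_iff_not_congr
    (Coloring.mk c fun {i j} hij => h i (by simp) j (by simp) hij) w).1 (hl ▸ hodd)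
  tauto

theorem IsUnicyclic.sum_degree [Fintype V] {G : SimpleGraph V} [DecidableRel G.Adj]
    (hG : G.IsUnicyclic) : ∑ v, G.degree v = 2 * Fintype.card V := by
  rw [G.sum_degrees_eq_twice_card_edges, ← hG.2, ← coe_edgeFinset, Set.ncard_coe_finset]

theorem card_filter_adj_univ [Fintype V] (G : SimpleGraph V) [DecidableRel G.Adj] (v : V) :
    (Finset.univ.filter (G.Adj v)).card = G.degree v := by
  rw [← G.card_neighborFinset_eq_degree, neighborFinset_eq_filter]

variable [DecidableEq V]

theorem sum_card_filter_insert {G : SimpleGraph V} [DecidableRel G.Adj] {S : Finset V} {v : V}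
    (hv : v ∉ S) : ∑ w ∈ insert v S, ((insert v S).filter (G.Adj w)).card =
      ∑ w ∈ S, (S.filter (G.Adj w)).card + 2 * (S.filter (G.Adj v)).card := by
  rw [Finset.sum_insert hv, Finset.filter_insert, if_neg (G.irrefl)]
  have h : ∀ w ∈ S, ((insert v S).filter (G.Adj w)).card =
      (S.filter (G.Adj w)).card + if G.Adj v w then 1 else 0 := by
    intro w hw
    simp only [Finset.filter_insert, G.adj_comm v w]
    split_ifs with h
    · rw [Finset.card_insert_of_notMem (by simp [hv])]
    · rfl
  rw [Finset.sum_congr rfl h, Finset.sum_add_distrib, ← Finset.card_filter]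
  ring

variable [Fintype V]

/-- The bound for `det (1 + t Q)` on a connected set with as many edges as vertices which is not
bipartite; it is attained only if there is a dominating vertex. -/
theorem ConnectedOn.le_pminor_of_unicyclic {G : SimpleGraph V} [DecidableRel G.Adj] {t : ℝ}
    (ht : 0 < t) (n : ℕ) : ∀ S : Finset V, S.card = n → G.ConnectedOn S → G.NotBipartiteOn S →
      ∑ v ∈ S, (S.filter (G.Adj v)).card = 2 * n →
      (1 + t) ^ n * pendantCubic n t ≤ (1 + t) ^ 3 * G.pminor t S ∅ ∧
        ((¬ ∃ u ∈ S, ∀ w ∈ S, w ≠ u → G.Adj u w) →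
          (1 + t) ^ n * pendantCubic n t < (1 + t) ^ 3 * G.pminor t S ∅) := by
  induction n with
  | zero =>
    intro S hn hS
    exact (hS.1.ne_empty (Finset.card_eq_zero.1 hn)).elim
  | succ n ih =>
  intro S hn hS hnb hsum
  by_cases hleaf : ∃ v ∈ S, (S.filter (G.Adj v)).card = 1
  · obtain ⟨v, hvS, hv1⟩ := hleaf
    obtain ⟨S₀, hv, rfl⟩ : ∃ S₀, v ∉ S₀ ∧ S = insert v S₀ :=
      ⟨S.erase v, by simp, (Finset.insert_erase hvS).symm⟩
    rw [Finset.filter_insert, if_neg (G.irrefl)] at hv1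
    obtain ⟨a, ha⟩ := Finset.card_eq_one.1 hv1
    have hmem : ∀ b, (b ∈ S₀ ∧ G.Adj v b) ↔ b = a := by
      intro b
      rw [← Finset.mem_filter, ha, Finset.mem_singleton]
    obtain ⟨haS, hva⟩ := (hmem a).2 rfl
    have huniq : ∀ b ∈ S₀, G.Adj v b → b = a := fun b hb hvb => (hmem b).1 ⟨hb, hvb⟩
    have hn' : S₀.card = n := by
      rw [Finset.card_insert_of_notMem hv] at hn
      omega
    rw [sum_card_filter_insert hv, hv1] at hsum
    have hS₀ := hS.of_insert hv haS huniq
    have hnb₀ := hnb.of_insert hv huniq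
    have h1 := (ih S₀ hn' hS₀ hnb₀ (by omega)).1
    obtain ⟨h2, h3⟩ := hS₀.le_pminor_singleton ht hnb₀ haS
    rw [hn'] at h2 h3
    have h4 := pminor_insert_ge_of_notMem (R := ∅) ht.le hv (Finset.notMem_empty v) haS
      (Finset.notMem_empty a) hva
    rw [insert_empty_eq] at h4
    have h5 := mul_le_mul_of_nonneg_left h4 (show 0 ≤ (1 + t) ^ 3 by positivity)
    have h6 := mul_le_mul_of_nonneg_left h1 (show 0 ≤ 1 + t by positivity)
    -- `pendantCubic (n + 1) t - pendantCubic n t = t (1 + 3 t)`: the target satisfies the leaf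
    -- recursion with equality.
    have h7 : (1 + t) ^ (n + 1) * pendantCubic (n + 1) t =
        (1 + t) * ((1 + t) ^ n * pendantCubic n t) +
          (1 + t) * t * ((1 + t) ^ n * (1 + 3 * t)) := by
      simp only [pendantCubic]
      push_cast
      ring
    rw [h7]
    refine ⟨?_, fun hdom => ?_⟩
    · have h8 := mul_le_mul_of_nonneg_left h2 (show 0 ≤ (1 + t) * t by positivity)
      linarith
    · have hw : ∃ w ∈ S₀, w ≠ a ∧ ¬ G.Adj a w := by
        by_contra! hcon
        refine hdom ⟨a, Finset.mem_insert_of_mem haS, fun w hw hwa => ?_⟩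
        rcases Finset.mem_insert.1 hw with rfl | hw
        · exact hva.symm
        · exact hcon w hw hwa
      have h8 := mul_lt_mul_of_pos_left (h3 hw) (show 0 < (1 + t) * t by positivity)
      linarith
  · push Not at hleaf
    refine ConnectedOn.le_pminor_of_two_regular ht (n + 1) G S hn hS hnb ?_
    -- Without leaves all degrees are at least `2`, while their average is `2`; so the graph is
    -- 2-regular.
    have hge : ∀ v ∈ S, 2 ≤ (S.filter (G.Adj v)).card := by
      intro v hv
      have hne : {v} ≠ S := by
        rintro rfl
        obtain ⟨i, hi, j, hj, hij, -⟩ := hnb fun _ => true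
        rw [Finset.mem_singleton] at hi hj
        exact G.irrefl (hi ▸ hj ▸ hij)
      obtain ⟨p, hp, b, hb, -, hpb⟩ := hS.2 {v} (by simpa) (by simp) hne
      rw [Finset.mem_singleton] at hp
      subst hp
      have h0 : 0 < (S.filter (G.Adj p)).card :=
        Finset.card_pos.2 ⟨b, Finset.mem_filter.2 ⟨hb, hpb⟩⟩
      have h1 := hleaf p hv
      omega
    have heq : ∑ _v ∈ S, 2 = ∑ v ∈ S, (S.filter (G.Adj v)).card := by
      rw [hsum, Finset.sum_const, hn, smul_eq_mul, mul_comm]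
    intro v hv
    exact (((Finset.sum_eq_sum_iff_of_le hge).1 heq) v hv).symm

/-- The bound for unicyclic graphs of odd girth. -/
theorem IsUnicyclic.le_det {G : SimpleGraph V} [DecidableRel G.Adj] {t : ℝ} (ht : 0 < t)
    (hG : G.IsUnicyclic) (hodd : Odd G.girth) :
    (1 + t) ^ Fintype.card V * pendantCubic (Fintype.card V) t ≤
        (1 + t) ^ 3 * (1 + t • G.signlessLapMatrix).det ∧
      ((¬ ∃ u, ∀ w, w ≠ u → G.Adj u w) →
        (1 + t) ^ Fintype.card V * pendantCubic (Fintype.card V) t <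
          (1 + t) ^ 3 * (1 + t • G.signlessLapMatrix).det) := by
  have h := hG.1.connectedOn_univ.le_pminor_of_unicyclic ht (Fintype.card V) _ Finset.card_univ
    (notBipartiteOn_univ_of_odd_girth hodd) (by simp only [card_filter_adj_univ, hG.sum_degree])
  simpa only [pminor, groundedMatrix_univ, Finset.mem_univ, true_and, true_implies] using h

end SimpleGraph

/-! ### From determinants to sums of square roots. -/

open Filter Topology

/-- An antiderivative of `log (1 + ν s ^ 2) / s ^ 2`, which vanishes at `0` and tends to `π √ν`
at infinity. -/
noncomputable def sqrtPrimitive (ν s : ℝ) : ℝ :=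
  2 * √ν * Real.arctan (√ν * s) - Real.log (1 + ν * s ^ 2) / s

theorem hasDerivAt_sqrtPrimitive {ν s : ℝ} (hν : 0 ≤ ν) (hs : 0 < s) :
    HasDerivAt (sqrtPrimitive ν) (Real.log (1 + ν * s ^ 2) / s ^ 2) s := by
  have hpos : 0 < 1 + ν * s ^ 2 := by positivity
  have h1 : HasDerivAt (fun s => √ν * s) √ν s := by
    simpa using (hasDerivAt_id s).const_mul √ν
  have h2 := (h1.arctan).const_mul (2 * √ν)
  have h3 : HasDerivAt (fun s => 1 + ν * s ^ 2) (ν * (2 * s)) s := by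
    simpa using ((hasDerivAt_pow 2 s).const_mul ν).const_add 1
  have h4 := (h3.log hpos.ne').div (hasDerivAt_id s) hs.ne'
  refine (h2.sub h4).congr_deriv ?_
  have h5 : (√ν * s) ^ 2 = ν * s ^ 2 := by rw [mul_pow, Real.sq_sqrt hν]
  have h6 : √ν * √ν = ν := Real.mul_self_sqrt hν
  simp only [h5, id]
  field_simp
  linear_combination (2 * s ^ 2) * h6

theorem tendsto_sqrtPrimitive_atTop {ν : ℝ} (hν : 0 ≤ ν) :
    Tendsto (sqrtPrimitive ν) atTop (𝓝 (Real.pi * √ν)) := by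
  have hlog : Tendsto (fun s : ℝ => Real.log (1 + ν * s ^ 2) / s) atTop (𝓝 0) := by
    -- For `s ≥ 1`, `1 + ν s² ≤ (1 + ν) s²`, which gives this majorant.
    have h1 : Tendsto (fun s : ℝ => (Real.log (1 + ν) + 2 * Real.log s) / s) atTop (𝓝 0) := by
      have h2 : Tendsto (fun s : ℝ => Real.log s / s) atTop (𝓝 0) := by
        simpa using Real.tendsto_pow_log_div_mul_add_atTop 1 0 1 one_ne_zero
      have h3 : Tendsto (fun s : ℝ => Real.log (1 + ν) / s) atTop (𝓝 0) :=
        tendsto_const_nhds.div_atTop tendsto_id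
      have := h3.add (h2.const_mul 2)
      simp only [mul_zero, add_zero] at this
      refine this.congr fun s => ?_
      ring
    refine tendsto_of_tendsto_of_tendsto_of_le_of_le' tendsto_const_nhds h1 ?_ ?_
    · filter_upwards [eventually_ge_atTop 1] with s hs
      have : 0 ≤ Real.log (1 + ν * s ^ 2) := 
        Real.log_nonneg (by nlinarith [mul_nonneg hν (sq_nonneg s)])
      positivity
    · filter_upwards [eventually_ge_atTop 1] with s hs
      have hs0 : 0 < s := by linarith
      refine div_le_div_of_nonneg_right ?_ hs0.le
      have : Real.log (1 + ν) + 2 * Real.log s = Real.log ((1 + ν) * s ^ 2) := by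
        rw [Real.log_mul (by positivity) (by positivity), Real.log_pow]
        norm_num
      rw [this]
      refine Real.log_le_log (by positivity) ?_
      nlinarith
  have harctan : Tendsto (fun s : ℝ => 2 * √ν * Real.arctan (√ν * s)) atTop (𝓝 (Real.pi * √ν)) := by
    rcases hν.eq_or_lt with rfl | hν
    · simp
    · have h1 : Tendsto (fun s : ℝ => √ν * s) atTop atTop :=
        tendsto_id.const_mul_atTop (Real.sqrt_pos.2 hν)
      have h2 := (Real.tendsto_arctan_atTop.mono_right nhdsWithin_le_nhds).comp h1
      have h3 := h2.const_mul (2 * √ν)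
      rwa [show 2 * √ν * (Real.pi / 2) = Real.pi * √ν by ring] at h3
  have h := harctan.sub hlog
  rw [sub_zero] at h
  exact h

theorem tendsto_sqrtPrimitive_zero {ν : ℝ} (hν : 0 ≤ ν) :
    Tendsto (sqrtPrimitive ν) (𝓝[>] 0) (𝓝 0) := by
  have hlog : Tendsto (fun s : ℝ => Real.log (1 + ν * s ^ 2) / s) (𝓝[>] 0) (𝓝 0) := by
    have h1 : Tendsto (fun s : ℝ => ν * s) (𝓝[>] 0) (𝓝 0) := by
      have : Tendsto (fun s : ℝ => ν * s) (𝓝 0) (𝓝 (ν * 0)) :=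
        (continuous_const.mul continuous_id).tendsto 0
      rw [mul_zero] at this
      exact this.mono_left nhdsWithin_le_nhds
    refine tendsto_of_tendsto_of_tendsto_of_le_of_le' tendsto_const_nhds h1 ?_ ?_
    · filter_upwards [self_mem_nhdsWithin] with s hs
      have hs : 0 < s := hs
      have : 0 ≤ Real.log (1 + ν * s ^ 2) := 
        Real.log_nonneg (by nlinarith [mul_nonneg hν (sq_nonneg s)])
      positivity
    · filter_upwards [self_mem_nhdsWithin] with s hs
      have hs : 0 < s := hs
      rw [div_le_iff₀ hs]
      have := Real.log_le_sub_one_of_pos (show 0 < 1 + ν * s ^ 2 by positivity)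
      linarith
  have harctan : Tendsto (fun s : ℝ => 2 * √ν * Real.arctan (√ν * s)) (𝓝[>] 0) (𝓝 0) := by
    have : Continuous fun s : ℝ => 2 * √ν * Real.arctan (√ν * s) := by fun_prop
    have := this.tendsto 0
    simp only [mul_zero, Real.arctan_zero] at this
    exact this.mono_left nhdsWithin_le_nhds
  have h := harctan.sub hlog
  rw [sub_zero] at h
  exact h

theorem prod_one_add_sq_mul_pos {α : Type*} [Fintype α] {ρ : α → ℝ} (hρ : ∀ i, 0 ≤ ρ i)
    (s : ℝ) : 0 < ∏ i, (1 + s ^ 2 * ρ i) :=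
  Finset.prod_pos fun i _ => by have := hρ i; positivity

theorem hasDerivAt_sum_sqrtPrimitive {α : Type*} [Fintype α] {ρ : α → ℝ} (hρ : ∀ i, 0 ≤ ρ i)
    {s : ℝ} (hs : 0 < s) : HasDerivAt (fun s => ∑ i, sqrtPrimitive (ρ i) s)
      (Real.log (∏ i, (1 + s ^ 2 * ρ i)) / s ^ 2) s := by
  refine (HasDerivAt.fun_sum fun i _ => hasDerivAt_sqrtPrimitive (hρ i) hs).congr_deriv ?_
  rw [Real.log_prod (fun i _ => by have := hρ i; positivity), Finset.sum_div]
  simp only [mul_comm]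

/-- Comparison of sums of square roots through the products `∏ (1 + t ν)`. -/
theorem sum_sqrt_le_sum_sqrt {ι κ : Type*} [Fintype ι] [Fintype κ] {μ : ι → ℝ} {ν : κ → ℝ}
    (hμ : ∀ i, 0 ≤ μ i) (hν : ∀ i, 0 ≤ ν i)
    (h : ∀ t : ℝ, 0 < t → ∏ i, (1 + t * μ i) ≤ ∏ i, (1 + t * ν i)) :
    ∑ i, √(μ i) ≤ ∑ i, √(ν i) ∧
      ((∀ t : ℝ, 0 < t → ∏ i, (1 + t * μ i) < ∏ i, (1 + t * ν i)) →
        ∑ i, √(μ i) < ∑ i, √(ν i)) := by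
  -- The derivative of `F` is the logarithm of the quotient of the two products at `t = s²`, divided
  -- by `s²`. So `F` increases from `0` to `π` times the difference of the two sums, and no improper
  -- integral is needed.
  set F : ℝ → ℝ := fun s => ∑ i, sqrtPrimitive (ν i) s - ∑ i, sqrtPrimitive (μ i) s with hF
  have hderiv : ∀ s : ℝ, 0 < s → HasDerivAt F
      ((Real.log (∏ i, (1 + s ^ 2 * ν i)) - Real.log (∏ i, (1 + s ^ 2 * μ i))) / s ^ 2) s := by
    intro s hs
    rw [sub_div]
    exact (hasDerivAt_sum_sqrtPrimitive hν hs).sub (hasDerivAt_sum_sqrtPrimitive hμ hs)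
  have hcont : ContinuousOn F (Set.Ioi 0) := fun s hs =>
    (hderiv s hs).continuousAt.continuousWithinAt
  have hmono : MonotoneOn F (Set.Ioi 0) := by
    refine monotoneOn_of_deriv_nonneg (convex_Ioi 0) hcont
      (fun s hs => (hderiv s (by simpa using hs)).differentiableAt.differentiableWithinAt)
      fun s hs => ?_
    have hs : 0 < s := by simpa using hs
    rw [(hderiv s hs).deriv]
    have := Real.log_le_log (prod_one_add_sq_mul_pos hμ s) (h (s ^ 2) (by positivity))
    exact div_nonneg (by linarith) (by positivity)
  have hzero : Tendsto F (𝓝[>] 0) (𝓝 0) := by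
    have h1 := tendsto_finsetSum Finset.univ fun i (_ : i ∈ Finset.univ) =>
      tendsto_sqrtPrimitive_zero (hν i)
    have h2 := tendsto_finsetSum Finset.univ fun i (_ : i ∈ Finset.univ) =>
      tendsto_sqrtPrimitive_zero (hμ i)
    simpa using h1.sub h2
  have htop : Tendsto F atTop (𝓝 (Real.pi * (∑ i, √(ν i) - ∑ i, √(μ i)))) := by
    have h1 := tendsto_finsetSum Finset.univ fun i (_ : i ∈ Finset.univ) =>
      tendsto_sqrtPrimitive_atTop (hν i)
    have h2 := tendsto_finsetSum Finset.univ fun i (_ : i ∈ Finset.univ) =>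
      tendsto_sqrtPrimitive_atTop (hμ i)
    rw [mul_sub, Finset.mul_sum, Finset.mul_sum]
    exact h1.sub h2
  have hge : ∀ s : ℝ, 0 < s → 0 ≤ F s := fun s hs => by
    refine le_of_tendsto hzero ?_
    filter_upwards [Ioo_mem_nhdsGT hs] with r hr
    exact hmono hr.1 hs hr.2.le
  have hle : ∀ s : ℝ, 0 < s → F s ≤ Real.pi * (∑ i, √(ν i) - ∑ i, √(μ i)) := fun s hs => by
    refine ge_of_tendsto htop ?_
    filter_upwards [eventually_ge_atTop s] with r hr
    exact hmono hs (hs.trans_le hr) hr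
  refine ⟨?_, fun hlt => ?_⟩
  · have := (hge 1 one_pos).trans (hle 1 one_pos)
    have := nonneg_of_mul_nonneg_right this Real.pi_pos
    linarith
  · have hstrict : StrictMonoOn F (Set.Ioi 0) := by
      refine strictMonoOn_of_deriv_pos (convex_Ioi 0) hcont fun s hs => ?_
      have hs : 0 < s := by simpa using hs
      rw [(hderiv s hs).deriv]
      have := Real.log_lt_log (prod_one_add_sq_mul_pos hμ s) (hlt (s ^ 2) (by positivity))
      exact div_pos (by linarith) (by positivity)
    -- Strictness survives the limits through the fixed gap `0 ≤ F 1 < F 2`.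
    have h1 := hstrict (show (1 : ℝ) ∈ Set.Ioi 0 by simp) (show (2 : ℝ) ∈ Set.Ioi 0 by simp)
      one_lt_two
    have := (hge 1 one_pos).trans_lt (h1.trans_le (hle 2 two_pos))
    have := pos_of_mul_pos_right this Real.pi_pos.le
    linarith

theorem Matrix.IsHermitian.det_one_add_smul {V : Type*} [Fintype V] [DecidableEq V]
    {A : Matrix V V ℝ} (hA : A.IsHermitian) (t : ℝ) :
    (1 + t • A).det = ∏ i, (1 + t * hA.eigenvalues i) := by
  have h : 1 + t • A = Unitary.conjStarAlgAut ℝ _ hA.eigenvectorUnitary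
      (diagonal fun i => 1 + t * hA.eigenvalues i) := by
    have hd : (diagonal fun i => 1 + t * hA.eigenvalues i) =
        1 + t • diagonal (RCLike.ofReal ∘ hA.eigenvalues) := by
      ext i j
      by_cases hij : i = j
      · subst hij
        simp
      · simp [hij]
    rw [hd, map_add, map_one, map_smul, ← hA.spectral_theorem]
  rw [h, Unitary.conjStarAlgAut_apply, det_mul_right_comm, Unitary.mul_star_self_of_mem, one_mul,
    det_diagonal]
  simp

namespace SimpleGraph

theorem incidenceEnergy_le {V W : Type*} [Fintype V] [DecidableEq V] [Fintype W] [DecidableEq W]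
    {G : SimpleGraph V} [DecidableRel G.Adj] {H : SimpleGraph W} [DecidableRel H.Adj]
    (h : ∀ t : ℝ, 0 < t → (1 + t • G.signlessLapMatrix).det ≤ (1 + t • H.signlessLapMatrix).det) :
    G.incidenceEnergy ≤ H.incidenceEnergy ∧
      ((∀ t : ℝ, 0 < t → (1 + t • G.signlessLapMatrix).det < (1 + t • H.signlessLapMatrix).det) →
        G.incidenceEnergy < H.incidenceEnergy) := by
  simp only [G.isHermitian_signlessLapMatrix.det_one_add_smul,
    H.isHermitian_signlessLapMatrix.det_one_add_smul] at h ⊢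
  exact sum_sqrt_le_sum_sqrt (G.posSemidef_signlessLapMatrix.eigenvalues_nonneg)
    (H.posSemidef_signlessLapMatrix.eigenvalues_nonneg) h

end SimpleGraph

/-! ### The extremal graph and its determinant. -/

section Adj

variable {k : ℕ}

@[simp]
theorem trianglePendant_adj_inl_inl {a b : Fin 3} :
    (trianglePendant k).Adj (.inl a) (.inl b) ↔ a ≠ b := Iff.rfl

@[simp]
theorem trianglePendant_adj_inl_inr {a : Fin 3} {b : Fin k} :
    (trianglePendant k).Adj (.inl a) (.inr b) ↔ a = 2 := Iff.rfl

@[simp]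
theorem trianglePendant_adj_inr_inl {a : Fin k} {b : Fin 3} :
    (trianglePendant k).Adj (.inr a) (.inl b) ↔ b = 2 := Iff.rfl

@[simp]
theorem trianglePendant_adj_inr_inr {a b : Fin k} :
    ¬ (trianglePendant k).Adj (.inr a) (.inr b) := id

end Adj

theorem trianglePendant_connected (k : ℕ) : (trianglePendant k).Connected := by
  have h : ∀ x, (trianglePendant k).Reachable (.inl 2) x := by
    rintro (a | a)
    · by_cases ha : a = 2
      · rw [ha]
      · exact SimpleGraph.Adj.reachable (show (2 : Fin 3) ≠ a from Ne.symm ha)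
    · exact SimpleGraph.Adj.reachable (show (2 : Fin 3) = 2 from rfl)
  have : Nonempty (Fin 3 ⊕ Fin k) := ⟨.inl 2⟩
  exact ⟨fun x y => (h x).symm.trans (h y)⟩

theorem trianglePendant_degree (k : ℕ) (x : Fin 3 ⊕ Fin k) :
    (trianglePendant k).degree x = Sum.elim ![2, 2, 2 + k] (fun _ => 1) x := by
  rw [← SimpleGraph.card_filter_adj_univ, Finset.card_filter, Fintype.sum_sum_type,
    Fin.sum_univ_three]
  rcases x with a | a
  · fin_cases a <;> simp
  · simp

theorem trianglePendant_isUnicyclic (k : ℕ) : (trianglePendant k).IsUnicyclic := by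
  refine ⟨trianglePendant_connected k, ?_⟩
  have h := (trianglePendant k).sum_degrees_eq_twice_card_edges
  simp only [trianglePendant_degree, Fintype.sum_sum_type, Fin.sum_univ_three] at h
  rw [← SimpleGraph.coe_edgeFinset, Set.ncard_coe_finset]
  simp at h ⊢
  omega

theorem trianglePendant_girth (k : ℕ) : (trianglePendant k).girth = 3 := by
  have hc : (⊤ : SimpleGraph (Fin 3)).IsContained (trianglePendant k) :=
    ⟨⟨⟨Sum.inl, fun h => h⟩, Sum.inl_injective⟩⟩
  have h3 : (⊤ : SimpleGraph (Fin 3)).egirth = 3 := SimpleGraph.egirth_top (by simp)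
  have h1 := hc.egirth_le
  rw [h3] at h1
  have h2 := (trianglePendant k).three_le_egirth
  rw [SimpleGraph.girth, le_antisymm h1 h2]
  rfl

theorem det_trianglePendant (k : ℕ) {t : ℝ} (ht : 0 < t) :
    (1 + t) ^ 3 * (1 + t • (trianglePendant k).signlessLapMatrix).det =
      (1 + t) ^ (3 + k) * SimpleGraph.pendantCubic (3 + k) t := by
  set A : Matrix (Fin 3) (Fin 3) ℝ :=
    !![1 + 2 * t, t, t; t, 1 + 2 * t, t; t, t, 1 + (2 + k) * t] with hA
  set B : Matrix (Fin 3) (Fin k) ℝ := of fun i _ => if i = 2 then t else 0 with hB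
  have ht' : 1 + t ≠ 0 := by positivity
  have hM : 1 + t • (trianglePendant k).signlessLapMatrix =
      fromBlocks A B Bᵀ (diagonal fun _ => 1 + t) := by
    ext (i | i) (j | j)
    · fin_cases i <;> fin_cases j <;>
        simp [hA, SimpleGraph.signlessLapMatrix, SimpleGraph.degMatrix, trianglePendant_degree,
          one_apply, mul_comm]
    · simp [hB, SimpleGraph.signlessLapMatrix, SimpleGraph.degMatrix]
    · simp [hB, SimpleGraph.signlessLapMatrix, SimpleGraph.degMatrix]
    · by_cases hij : i = j <;>
        simp [hij, SimpleGraph.signlessLapMatrix, SimpleGraph.degMatrix, trianglePendant_degree,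
          one_apply]
  -- A unit triangular factor clears the lower left block, leaving the 3 × 3 Schur complement of the
  -- pendent vertices.
  have hmul : (1 + t • (trianglePendant k).signlessLapMatrix) *
      fromBlocks 1 0 (-(1 + t)⁻¹ • Bᵀ) 1 =
      fromBlocks (A - (1 + t)⁻¹ • (B * Bᵀ)) B 0 (diagonal fun _ => 1 + t) := by
    rw [hM, fromBlocks_multiply]
    congr 1
    · simp [sub_eq_add_neg]
    · simp
    · ext i j
      simp [diagonal_mul, ht']
    · simp
  have hBB : A - (1 + t)⁻¹ • (B * Bᵀ) =
      !![1 + 2 * t, t, t; t, 1 + 2 * t, t; t, t, 1 + (2 + k) * t - (1 + t)⁻¹ * (k * (t * t))] := by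
    ext i j
    fin_cases i <;> fin_cases j <;> simp [hA, hB, mul_apply]
  have h := congrArg det hmul
  rw [det_mul, det_fromBlocks_zero₁₂, det_fromBlocks_zero₂₁, hBB, det_diagonal] at h
  simp only [det_one, mul_one, Finset.prod_const, Finset.card_univ, Fintype.card_fin] at h
  rw [h, det_fin_three]
  simp [SimpleGraph.pendantCubic, pow_add]
  field_simp
  ring

/-! ### The case of equality. -/

namespace SimpleGraph

variable {V W : Type*} [Fintype V] [DecidableEq V] [Fintype W] [DecidableEq W]

theorem Iso.det_one_add_smul {G : SimpleGraph V} [DecidableRel G.Adj] {H : SimpleGraph W}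
    [DecidableRel H.Adj] (e : G ≃g H) (t : ℝ) :
    (1 + t • G.signlessLapMatrix).det = (1 + t • H.signlessLapMatrix).det := by
  have h : 1 + t • G.signlessLapMatrix =
      (1 + t • H.signlessLapMatrix).submatrix e.toEquiv e.toEquiv := by
    ext i j
    have hadj : H.Adj (e i) (e j) ↔ G.Adj i j := e.map_adj_iff
    have hdeg : H.degree (e i) = G.degree i := e.degree_eq i
    simp [signlessLapMatrix, degMatrix, one_apply, diagonal_apply, hadj, hdeg]
  rw [h, det_submatrix_equiv_self]

theorem IsUnicyclic.nonempty_iso {G : SimpleGraph V} {k : ℕ} (hk : Fintype.card V = 3 + k)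
    (hG : G.IsUnicyclic) (hnb : G.NotBipartiteOn Finset.univ) {u : V}
    (hu : ∀ w, w ≠ u → G.Adj u w) : Nonempty (G ≃g trianglePendant k) := by
  -- Coloring `u` against all other vertices is not proper, and the violating edge `pq` avoids `u`;
  -- with the dominating `u` it forms a triangle.
  obtain ⟨p, -, q, -, hpq, hc⟩ := hnb fun w => decide (w = u)
  have hpu : p ≠ u := by
    rintro rfl
    exact hpq.ne' (by simpa using hc)
  have hqu : q ≠ u := by
    rintro rfl
    exact hpq.ne (by simpa using hc)
  -- Only the values on the triangle matter; the pendent vertices get a dummy value, and any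
  -- bijection extending the triangle will do.
  have hinj : Set.InjOn (Sum.elim ![p, q, u] fun _ => u : Fin 3 ⊕ Fin k → V)
      (Finset.univ.image Sum.inl : Finset (Fin 3 ⊕ Fin k)) := by
    intro x hx y hy hxy
    simp only [Finset.coe_image, Finset.coe_univ, Set.image_univ, Set.mem_range] at hx hy
    obtain ⟨a, rfl⟩ := hx
    obtain ⟨b, rfl⟩ := hy
    fin_cases a <;> fin_cases b <;>
      simp_all [hpq.ne, hpq.ne', hpu.symm, hqu.symm]
  obtain ⟨g, hg⟩ := Finset.exists_equiv_extend_of_card_eq (t := (Finset.univ : Finset V))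
    (by simp [hk]) (Finset.subset_univ _) hinj
  let e : Fin 3 ⊕ Fin k ≃ V := g.trans (Equiv.subtypeUnivEquiv (by simp))
  have he : ∀ a, e (Sum.inl a) = ![p, q, u] a := fun a => hg (Sum.inl a) (by simp)
  have he2 : e (.inl 2) = u := he 2
  have hle : (trianglePendant k).map e.toEmbedding ≤ G := by
    rw [map_le_iff_le_comap]
    rintro (a | a) (b | b) hab
    · have hab : a ≠ b := hab
      simp only [comap_adj, Equiv.coe_toEmbedding, he]
      fin_cases a <;> fin_cases b <;>
        simp_all [hpq.symm, hu p hpu, hu q hqu, (hu p hpu).symm, (hu q hqu).symm]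
    · obtain rfl : a = 2 := hab
      simp only [comap_adj, Equiv.coe_toEmbedding, he2]
      exact hu _ (fun h => by simpa using e.injective (h.trans he2.symm))
    · obtain rfl : b = 2 := hab
      simp only [comap_adj, Equiv.coe_toEmbedding, he2]
      exact (hu _ (fun h => by simpa using e.injective (h.trans he2.symm))).symm
    · exact hab.elim
  -- Both graphs have as many edges as vertices, so the inclusion of edge sets is an equality.
  have heq : (trianglePendant k).map e.toEmbedding = G := by
    rw [← edgeSet_inj]
    refine Set.eq_of_subset_of_ncard_le (edgeSet_mono hle) ?_ (Set.toFinite _)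
    rw [hG.2, edgeSet_map, Set.ncard_image_of_injective _ e.toEmbedding.sym2Map.injective,
      (trianglePendant_isUnicyclic k).2, hk]
    simp
  rw [← heq]
  exact ⟨(Iso.map e (trianglePendant k)).symm⟩

end SimpleGraph

theorem corollary5p3 (n : ℕ) (hn : 3 ≤ n) :
    (Fintype.card (Fin 3 ⊕ Fin (n - 3)) = n ∧
      (trianglePendant (n - 3)).IsUnicyclic ∧ Odd (trianglePendant (n - 3)).girth) ∧
    ∀ (V : Type*) [Fintype V] [DecidableEq V] (G : SimpleGraph V) [DecidableRel G.Adj],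
      Fintype.card V = n → G.IsUnicyclic → Odd G.girth →
        (trianglePendant (n - 3)).incidenceEnergy ≤ G.incidenceEnergy ∧
        (G.incidenceEnergy = (trianglePendant (n - 3)).incidenceEnergy ↔
          Nonempty (G ≃g trianglePendant (n - 3))) := by
  obtain ⟨k, rfl⟩ := Nat.exists_eq_add_of_le hn
  rw [Nat.add_sub_cancel_left]
  refine ⟨⟨by simp, trianglePendant_isUnicyclic k, by rw [trianglePendant_girth]; decide⟩, ?_⟩
  intro V _ _ G _ hV hG hodd
  have hdet := fun (t : ℝ) (ht : 0 < t) => hG.le_det ht hodd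
  simp only [hV] at hdet
  have hle : ∀ t : ℝ, 0 < t → (1 + t • (trianglePendant k).signlessLapMatrix).det ≤
      (1 + t • G.signlessLapMatrix).det := fun t ht => by
    refine le_of_mul_le_mul_left ?_ (show 0 < (1 + t) ^ 3 by positivity)
    rw [det_trianglePendant k ht]
    exact (hdet t ht).1
  obtain ⟨h1, h2⟩ := SimpleGraph.incidenceEnergy_le hle
  refine ⟨h1, fun heq => ?_, fun ⟨e⟩ => ?_⟩
  · by_cases hdom : ∃ u, ∀ w, w ≠ u → G.Adj u w
    · obtain ⟨u, hu⟩ := hdom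
      exact hG.nonempty_iso hV (SimpleGraph.notBipartiteOn_univ_of_odd_girth hodd) hu
    · refine absurd heq (h2 fun t ht => ?_).ne'
      refine lt_of_mul_lt_mul_left ?_ (show 0 ≤ (1 + t) ^ 3 by positivity)
      rw [det_trianglePendant k ht]
      exact (hdet t ht).2 hdom
  · exact le_antisymm (SimpleGraph.incidenceEnergy_le fun t _ => (e.det_one_add_smul t).le).1 h1
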